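/- Let $M=\Gamma\backslash G$ be a $6$-dimensional nilmanifold whose Lie algebra $\mathfrak g$ has a basis with dual basis $(e^1,\dots,e^6)$ of $\mathfrak g^*$ satisfying $$de^i=0\ (1\le i\le 4),\qquad de^5=e^{12},\qquad de^6=e^{14}+e^{23},$$ where $e^{ij}=e^i\wedge e^j$. Give $M$ the invariant metric $g=\sum_{i=1}^6 e^i\otimes e^i$ and the orientation $e^{123456}$. Let $\mathcal Z$ be the set of invariant $g$-orthogonal almost complex structures $J$ compatible with the orientation; a point $J$ of $\mathcal Z$ is identified with its fundamental $2$-form $\omega(X,Y)=g(JX,Y)$. Let $\mathcal W=\mathcal W_1\oplus\mathcal W_2\oplus\mathcal W_3\oplus\mathcal W_4$ be the Gray–Hervella decomposition of the space of tensors with the symmetries of $\nabla\omega$, where $\nabla$ is the Levi-Civita connection of $g$, and for distinct $i,j,k$ put $\mathcal Z_{ijk}=\{\omega\in\mathcal Z:\nabla\omega\in\mathcal W_i\oplus\mathcal W_j\oplus\mathcal W_k\}$. Let $\omega_0=e^{12}+e^{34}+e^{56}$, $\omega_1=e^{12}-e^{34}-e^{56}$, $\omega_2=-e^{12}+e^{34}-e^{56}$,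 $\omega_3=-e^{12}-e^{34}+e^{56}$, and $\varepsilon(\theta)=e^{56}+\cos\theta\,(e^{13}+e^{42})+\sin\theta\,(e^{14}+e^{23})$. For $\sigma=\alpha\wedge\beta$ with $\alpha,\beta$ orthonormal $1$-forms, let $\mathcal E(\sigma)$ be the set of points $\sigma+\tau$ of $\mathcal Z$ with $\tau\in\bigwedge^2\langle\alpha,\beta\rangle^\perp$, and let $\mathcal S_{02},\mathcal S_{13},\mathcal S_{12}$ be the equatorial circles $\mathcal S_{ij}=\{\omega\in\mathcal E_{ij}:g(\omega,\omega_i)=g(\omega,\omega_j)\}$ of the edges $\mathcal E_{02}=\mathcal E(e^{34})$, $\mathcal E_{13}=\mathcal E(-e^{34})$, $\mathcal E_{12}=\mathcal E(-e^{56})$. Let $\mathcal S$ and $\mathcal S'$ be the sets of the $2$-forms $$\mp(Ae^3+Be^4)\wedge e^5+(Ae^1-Be^2)\wedge e^6\pm(Be^1+Ae^2)\wedge(-Be^3+Ae^4),\qquad A^2+B^2=1,$$ with the upper signs for $\mathcal S$ and the lower signs for $\mathcal S'$. Then $\mathcal S$ and $\mathcal S'$ are (topological) circles, and $$\begin{aligned}\mathcal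 Z_{234}&\supseteq\{\omega_1,\omega_2,\varepsilon(\tfrac{2\pi}3),\varepsilon(-\tfrac{2\pi}3)\}\cup\mathcal S,\\ \mathcal Z_{134}&=\{\omega_1,\omega_2,\varepsilon(\tfrac{2\pi}3),\varepsilon(-\tfrac{2\pi}3)\},\\ \mathcal Z_{124}&=\mathcal S,\\ \mathcal Z_{123}&\supseteq\{\varepsilon(0),\varepsilon(\pi)\}\cup\mathcal S\cup\mathcal S'\cup\mathcal S_{02}\cup\mathcal S_{13}\cup\mathcal S_{12},\end{aligned}$$ where the listed points are distinct and all the unions are disjoint. -/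

import Mathlib

open Module

namespace NilHermitian

/-! Invariant tensors are tensors on the Lie algebra `L`.  The basis `e` of `L` is the frame
`(e_1, …, e_6)` (indexed from `0` to `5`), and `coframe e i` is the dual `1`-form. A `2`-form is
an alternating bilinear form, with `(α ∧ β)(X, Y) = α(X) β(Y) - α(Y) β(X)`. -/

section Defs

variable {L : Type*} [LieRing L] [LieAlgebra ℝ L]

/-- The `1`-forms of the coframe dual to `e`; with indices `0, …, 5` for `e^1, …, e^6`. -/
noncomputable def coframe (e : Basis (Fin 6) ℝ L) (i : Fin 6) : Dual ℝ L := e.coord i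

/-- The wedge product of two `1`-forms. -/
noncomputable def wedge (α β : Dual ℝ L) : LinearMap.BilinForm ℝ L :=
  α.smulRight β - β.smulRight α

/-- The `2`-form `e^{ij} = e^i ∧ e^j`, with the indices `i, j` running from `0` to `5`. -/
noncomputable def cf2 (e : Basis (Fin 6) ℝ L) (i j : Fin 6) : LinearMap.BilinForm ℝ L :=
  wedge (coframe e i) (coframe e j)

/-- The exterior derivative of an invariant `1`-form: `dα(X, Y) = -α([X, Y])`. -/
noncomputable def extD (α : Dual ℝ L) : LinearMap.BilinForm ℝ L :=
  LinearMap.mk₂ ℝ (fun X Y => -α ⁅X, Y⁆)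
    (by intro X X' Y; simp; ring) (by intro c X Y; simp)
    (by intro X Y Y'; simp; ring) (by intro c X Y; simp)

/-- The structure equations `de^i = 0` for `1 ≤ i ≤ 4`, `de^5 = e^{12}`, `de^6 = e^{14} + e^{23}`
(the indices are shifted by one). -/
structure StructureEquations (e : Basis (Fin 6) ℝ L) : Prop where
  closed : ∀ i : Fin 6, i < 4 → extD (coframe e i) = 0
  d_five : extD (coframe e 4) = cf2 e 0 1
  d_six : extD (coframe e 5) = cf2 e 0 3 + cf2 e 1 2

/-- The metric `g = ∑ e^i ⊗ e^i`. -/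
noncomputable def metric (e : Basis (Fin 6) ℝ L) : LinearMap.BilinForm ℝ L :=
  ∑ i, (coframe e i).smulRight (coframe e i)

/-- The Levi-Civita connection of `g` on invariant vector fields, given by the Koszul formula
`2 g(∇_X Y, Z) = g([X, Y], Z) - g([Y, Z], X) + g([Z, X], Y)`. It is characterized below as the
metric connection without torsion. -/
noncomputable def leviCivita (e : Basis (Fin 6) ℝ L) : L →ₗ[ℝ] L →ₗ[ℝ] L :=
  LinearMap.mk₂ ℝ
    (fun X Y => ∑ k, ((metric e ⁅X, Y⁆ (e k) - metric e ⁅Y, e k⁆ X + metric e ⁅e k, X⁆ Y) / 2) • e k)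
    (by
      intro X X' Y
      rw [← Finset.sum_add_distrib]
      refine Finset.sum_congr rfl fun k _ => ?_
      rw [← add_smul]; congr 1; simp; ring)
    (by
      intro c X Y
      rw [Finset.smul_sum]
      refine Finset.sum_congr rfl fun k _ => ?_
      rw [smul_smul]; congr 1; simp; ring)
    (by
      intro X Y Y'
      rw [← Finset.sum_add_distrib]
      refine Finset.sum_congr rfl fun k _ => ?_
      rw [← add_smul]; congr 1; simp; ring)
    (by
      intro c X Y
      rw [Finset.smul_sum]
      refine Finset.sum_congr rfl fun k _ => ?_
      rw [smul_smul]; congr 1; simp; ring)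

theorem metric_comm (e : Basis (Fin 6) ℝ L) (X Y : L) : metric e X Y = metric e Y X := by
  simp [metric, mul_comm]

theorem metric_basis (e : Basis (Fin 6) ℝ L) (X : L) (k : Fin 6) :
    metric e X (e k) = coframe e k X := by
  simp [metric, coframe, Finsupp.single_apply]

theorem metric_leviCivita (e : Basis (Fin 6) ℝ L) (X Y Z : L) :
    2 * metric e (leviCivita e X Y) Z =
      metric e ⁅X, Y⁆ Z - metric e ⁅Y, Z⁆ X + metric e ⁅Z, X⁆ Y := by
  have hZ : Z ∈ Submodule.span ℝ (Set.range e) := e.span_eq ▸ Submodule.mem_top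
  induction hZ using Submodule.span_induction with
  | mem _ h =>
    obtain ⟨k, rfl⟩ := h
    rw [metric_basis]
    simp [leviCivita, coframe, Finsupp.single_apply]
    ring
  | zero => simp
  | add Z Z' _ _ h h' => simp [mul_add, h, h']; ring
  | smul c Z _ h => simp [mul_left_comm _ c, h]; ring

theorem metric_ext (e : Basis (Fin 6) ℝ L) {X Y : L} (h : ∀ Z, metric e X Z = metric e Y Z) :
    X = Y :=
  e.ext_elem fun k => by simpa [metric_basis, coframe] using h (e k)

/-- `leviCivita e` is the unique connection that has no torsion and preserves the metric. -/
theorem leviCivita_iff (e : Basis (Fin 6) ℝ L) (D : L →ₗ[ℝ] L →ₗ[ℝ] L) :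
    D = leviCivita e ↔
      (∀ X Y, D X Y - D Y X = ⁅X, Y⁆) ∧
        ∀ X Y Z, metric e (D X Y) Z + metric e Y (D X Z) = 0 := by
  have sk : ∀ X Y Z : L, metric e ⁅X, Y⁆ Z = -metric e ⁅Y, X⁆ Z := fun X Y Z => by
    rw [← lie_skew X Y, map_neg, LinearMap.neg_apply]
  constructor
  · rintro rfl
    refine ⟨fun X Y => metric_ext e fun Z => ?_, fun X Y Z => ?_⟩
    · have h1 := metric_leviCivita e X Y Z
      have h2 := metric_leviCivita e Y X Z
      simp only [map_sub, LinearMap.sub_apply]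
      linarith [sk X Y Z, sk X Z Y, sk Y Z X]
    · have h1 := metric_leviCivita e X Y Z
      have h2 := metric_leviCivita e X Z Y
      rw [metric_comm e Y]
      linarith [sk X Y Z, sk X Z Y, sk Y Z X]
  · rintro ⟨ht, hm⟩
    have ht' : ∀ X Y Z, metric e (D X Y) Z - metric e (D Y X) Z = metric e ⁅X, Y⁆ Z :=
      fun X Y Z => by rw [← ht]; simp
    refine LinearMap.ext₂ fun X Y => metric_ext e fun Z => ?_
    linarith [metric_leviCivita e X Y Z, ht' X Y Z, ht' Y Z X, ht' Z X Y, hm X Y Z, hm Y Z X,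
      hm Z X Y, metric_comm e Y (D X Z), metric_comm e Z (D Y X), metric_comm e X (D Z Y)]

/-- Invariant tensors of degree three. -/
abbrev Tensor3 (L : Type*) [AddCommGroup L] [Module ℝ L] : Type _ :=
  L →ₗ[ℝ] LinearMap.BilinForm ℝ L

/-- The covariant derivative `(∇_X ω)(Y, Z) = -ω(∇_X Y, Z) - ω(Y, ∇_X Z)` of an invariant
`2`-form. -/
noncomputable def covDeriv (e : Basis (Fin 6) ℝ L) (ω : LinearMap.BilinForm ℝ L) : Tensor3 L where
  toFun X := -(ω ∘ₗ leviCivita e X) - ω.compl₂ (leviCivita e X)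
  map_add' X X' := by ext Y Z; simp; ring
  map_smul' c X := by ext Y Z; simp; ring

/-- The fundamental `2`-form `ω(X, Y) = g(JX, Y)`. -/
noncomputable def fundamentalForm (e : Basis (Fin 6) ℝ L) (J : Module.End ℝ L) :
    LinearMap.BilinForm ℝ L :=
  metric e ∘ₗ J

/-- The Pfaffian of a `2`-form `ω` in the frame `e`: `ω ∧ ω ∧ ω = 6 Pf(ω) e^{123456}`. -/
noncomputable def pfaffian (e : Basis (Fin 6) ℝ L) (ω : LinearMap.BilinForm ℝ L) : ℝ :=
  let a : Fin 6 → Fin 6 → ℝ := fun i j => ω (e i) (e j)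
  a 0 1 * (a 2 3 * a 4 5 - a 2 4 * a 3 5 + a 2 5 * a 3 4)
    - a 0 2 * (a 1 3 * a 4 5 - a 1 4 * a 3 5 + a 1 5 * a 3 4)
    + a 0 3 * (a 1 2 * a 4 5 - a 1 4 * a 2 5 + a 1 5 * a 2 4)
    - a 0 4 * (a 1 2 * a 3 5 - a 1 3 * a 2 5 + a 1 5 * a 2 3)
    + a 0 5 * (a 1 2 * a 3 4 - a 1 3 * a 2 4 + a 1 4 * a 2 3)

/-- `J` is an almost complex structure that is orthogonal for `g` and induces the orientation of
`e^{123456}`, so that `ω ∧ ω ∧ ω` is a positive multiple of `e^{123456}`. -/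
structure IsCompatible (e : Basis (Fin 6) ℝ L) (J : Module.End ℝ L) : Prop where
  sq : ∀ X, J (J X) = -X
  orthogonal : ∀ X Y, metric e (J X) (J Y) = metric e X Y
  oriented : 0 < pfaffian e (fundamentalForm e J)

/-- The space `𝒵`, a point of which is given by its fundamental `2`-form. -/
def spaceZ (e : Basis (Fin 6) ℝ L) : Set (LinearMap.BilinForm ℝ L) :=
  {ω | ∃ J, IsCompatible e J ∧ ω = fundamentalForm e J}

/-! ### The Gray-Hervella decomposition -/

/-- The space `𝒲` of tensors with the symmetries of `∇ω`. -/
def ghSpace (J : Module.End ℝ L) : Submodule ℝ (Tensor3 L) where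
  carrier := {α | ∀ X Y Z, α X Y Z = -α X Z Y ∧ α X (J Y) (J Z) = -α X Y Z}
  zero_mem' := by simp
  add_mem' {α β} ha hb X Y Z := by
    have h1 := ha X Y Z
    have h2 := hb X Y Z
    simp only [LinearMap.add_apply]
    constructor <;> linarith
  smul_mem' c α ha X Y Z := by
    have h1 := ha X Y Z
    simp only [LinearMap.smul_apply, smul_eq_mul]
    constructor
    · rw [h1.1]; ring
    · rw [h1.2]; ring

/-- `𝒲₁`: the totally skew tensors in `𝒲`. -/
def ghW1 (J : Module.End ℝ L) : Submodule ℝ (Tensor3 L) where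
  carrier := {α | α ∈ ghSpace J ∧ ∀ X Z, α X X Z = 0}
  zero_mem' := by simp
  add_mem' {α β} ha hb := ⟨add_mem ha.1 hb.1, fun X Z => by simp [ha.2, hb.2]⟩
  smul_mem' c α ha := ⟨Submodule.smul_mem _ c ha.1, fun X Z => by simp [ha.2]⟩

/-- `𝒲₂`: the tensors in `𝒲` whose cyclic sums vanish. -/
def ghW2 (J : Module.End ℝ L) : Submodule ℝ (Tensor3 L) where
  carrier := {α | α ∈ ghSpace J ∧ ∀ X Y Z, α X Y Z + α Y Z X + α Z X Y = 0}
  zero_mem' := by simp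
  add_mem' {α β} ha hb := ⟨add_mem ha.1 hb.1, fun X Y Z => by
    have h1 := ha.2 X Y Z
    have h2 := hb.2 X Y Z
    simp only [LinearMap.add_apply]
    linarith⟩
  smul_mem' c α ha := ⟨Submodule.smul_mem _ c ha.1, fun X Y Z => by
    have h1 := ha.2 X Y Z
    simp only [LinearMap.smul_apply, smul_eq_mul]
    linear_combination c * h1⟩

/-- `𝒲₃`: the trace-free tensors in `𝒲` with `α(JX, JY, Z) = α(X, Y, Z)`. -/
def ghW3 (e : Basis (Fin 6) ℝ L) (J : Module.End ℝ L) : Submodule ℝ (Tensor3 L) where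
  carrier := {α | α ∈ ghSpace J ∧ (∀ X Y Z, α (J X) (J Y) Z = α X Y Z) ∧
    ∀ Z, ∑ i, α (e i) (e i) Z = 0}
  zero_mem' := by simp
  add_mem' {α β} ha hb := ⟨add_mem ha.1 hb.1, fun X Y Z => by simp [ha.2.1, hb.2.1],
    fun Z => by simp [Finset.sum_add_distrib, ha.2.2, hb.2.2]⟩
  smul_mem' c α ha := ⟨Submodule.smul_mem _ c ha.1, fun X Y Z => by simp [ha.2.1],
    fun Z => by simp [← Finset.mul_sum, ha.2.2]⟩

/-- `𝒲₄`: the tensors in `𝒲` that are determined by a `1`-form `θ`. -/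
def ghW4 (e : Basis (Fin 6) ℝ L) (J : Module.End ℝ L) : Submodule ℝ (Tensor3 L) where
  carrier := {α | α ∈ ghSpace J ∧ ∃ θ : Dual ℝ L, ∀ X Y Z, α X Y Z =
    metric e X Y * θ Z - metric e X Z * θ Y
      - metric e X (J Y) * θ (J Z) + metric e X (J Z) * θ (J Y)}
  zero_mem' := ⟨Submodule.zero_mem _, 0, by simp⟩
  add_mem' := by
    rintro α β ⟨ha, θ, hθ⟩ ⟨hb, η, hη⟩
    exact ⟨add_mem ha hb, θ + η, fun X Y Z => by simp [hθ, hη]; ring⟩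
  smul_mem' := by
    rintro c α ⟨ha, θ, hθ⟩
    exact ⟨Submodule.smul_mem _ c ha, c • θ, fun X Y Z => by simp [hθ]; ring⟩

/-- The points of `𝒵` for which `∇ω` lies in the subspace `V J` of `𝒲`. -/
def ghClass (e : Basis (Fin 6) ℝ L) (V : Module.End ℝ L → Submodule ℝ (Tensor3 L)) :
    Set (LinearMap.BilinForm ℝ L) :=
  {ω | ∃ J, IsCompatible e J ∧ ω = fundamentalForm e J ∧ covDeriv e ω ∈ V J}

/-- `𝒵₂₃₄`, where `∇ω` has no component in `𝒲₁`. -/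
def Z234 (e : Basis (Fin 6) ℝ L) : Set (LinearMap.BilinForm ℝ L) :=
  ghClass e fun J => ghW2 J ⊔ ghW3 e J ⊔ ghW4 e J

/-- `𝒵₁₃₄`, where `∇ω` has no component in `𝒲₂`. -/
def Z134 (e : Basis (Fin 6) ℝ L) : Set (LinearMap.BilinForm ℝ L) :=
  ghClass e fun J => ghW1 J ⊔ ghW3 e J ⊔ ghW4 e J

/-- `𝒵₁₂₄`, where `∇ω` has no component in `𝒲₃`. -/
def Z124 (e : Basis (Fin 6) ℝ L) : Set (LinearMap.BilinForm ℝ L) :=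
  ghClass e fun J => ghW1 J ⊔ ghW2 J ⊔ ghW4 e J

/-- `𝒵₁₂₃`, where `∇ω` has no component in `𝒲₄`. -/
def Z123 (e : Basis (Fin 6) ℝ L) : Set (LinearMap.BilinForm ℝ L) :=
  ghClass e fun J => ghW1 J ⊔ ghW2 J ⊔ ghW3 e J

/-! ### Points, edges and circles in `𝒵` -/

/-- The vertex `ω₀ = e^{12} + e^{34} + e^{56}`. -/
noncomputable def vertex0 (e : Basis (Fin 6) ℝ L) : LinearMap.BilinForm ℝ L :=
  cf2 e 0 1 + cf2 e 2 3 + cf2 e 4 5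

/-- The vertex `ω₁ = e^{12} - e^{34} - e^{56}`. -/
noncomputable def vertex1 (e : Basis (Fin 6) ℝ L) : LinearMap.BilinForm ℝ L :=
  cf2 e 0 1 - cf2 e 2 3 - cf2 e 4 5

/-- The vertex `ω₂ = -e^{12} + e^{34} - e^{56}`. -/
noncomputable def vertex2 (e : Basis (Fin 6) ℝ L) : LinearMap.BilinForm ℝ L :=
  -cf2 e 0 1 + cf2 e 2 3 - cf2 e 4 5

/-- The vertex `ω₃ = -e^{12} - e^{34} + e^{56}`. -/
noncomputable def vertex3 (e : Basis (Fin 6) ℝ L) : LinearMap.BilinForm ℝ L :=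
  -cf2 e 0 1 - cf2 e 2 3 + cf2 e 4 5

/-- The form `ε(θ) = e^{56} + cos θ (e^{13} + e^{42}) + sin θ (e^{14} + e^{23})`. -/
noncomputable def eps (e : Basis (Fin 6) ℝ L) (θ : ℝ) : LinearMap.BilinForm ℝ L :=
  cf2 e 4 5 + Real.cos θ • (cf2 e 0 2 + cf2 e 3 1) + Real.sin θ • (cf2 e 0 3 + cf2 e 1 2)

/-- The metric induced on `1`-forms. -/
noncomputable def inner1 (e : Basis (Fin 6) ℝ L) (α β : Dual ℝ L) : ℝ :=
  ∑ i, α (e i) * β (e i)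

/-- The metric induced on `2`-forms, for which the `e^{ij}` with `i < j` are orthonormal. -/
noncomputable def inner2 (e : Basis (Fin 6) ℝ L) (σ τ : LinearMap.BilinForm ℝ L) : ℝ :=
  ∑ i, ∑ j ∈ Finset.Ioi i, σ (e i) (e j) * τ (e i) (e j)

/-- The edge determined by `σ = α ∧ β`, for orthonormal `α` and `β`: the points `σ + τ` of `𝒵`
with `τ` in the second exterior power of the orthogonal complement of `⟨α, β⟩`. -/
def edge (e : Basis (Fin 6) ℝ L) (α β : Dual ℝ L) : Set (LinearMap.BilinForm ℝ L) :=
  {ω | ω ∈ spaceZ e ∧ ∃ τ ∈ Submodule.span ℝ {ρ : LinearMap.BilinForm ℝ L | ∃ γ δ : Dual ℝ L,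
      (inner1 e γ α = 0 ∧ inner1 e γ β = 0) ∧ (inner1 e δ α = 0 ∧ inner1 e δ β = 0) ∧
      ρ = wedge γ δ},
    ω = wedge α β + τ}

/-- The equatorial circle `𝒮₀₂` in the edge of `e^{34}`, which joins `ω₀` and `ω₂`. -/
def equator02 (e : Basis (Fin 6) ℝ L) : Set (LinearMap.BilinForm ℝ L) :=
  {ω | ω ∈ edge e (coframe e 2) (coframe e 3) ∧ inner2 e ω (vertex0 e) = inner2 e ω (vertex2 e)}

/-- The equatorial circle `𝒮₁₃` in the edge of `-e^{34} = e^{43}`, which joins `ω₁` and `ω₃`. -/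
def equator13 (e : Basis (Fin 6) ℝ L) : Set (LinearMap.BilinForm ℝ L) :=
  {ω | ω ∈ edge e (coframe e 3) (coframe e 2) ∧ inner2 e ω (vertex1 e) = inner2 e ω (vertex3 e)}

/-- The equatorial circle `𝒮₁₂` in the edge of `-e^{56} = e^{65}`, which joins `ω₁` and `ω₂`. -/
def equator12 (e : Basis (Fin 6) ℝ L) : Set (LinearMap.BilinForm ℝ L) :=
  {ω | ω ∈ edge e (coframe e 5) (coframe e 4) ∧ inner2 e ω (vertex1 e) = inner2 e ω (vertex2 e)}

/-- The set `𝒮` of the forms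
`-(A e^3 + B e^4) ∧ e^5 + (A e^1 - B e^2) ∧ e^6 + (B e^1 + A e^2) ∧ (-B e^3 + A e^4)` with
`A^2 + B^2 = 1`. -/
def circleS (e : Basis (Fin 6) ℝ L) : Set (LinearMap.BilinForm ℝ L) :=
  {ω | ∃ A B : ℝ, A ^ 2 + B ^ 2 = 1 ∧
    ω = -wedge (A • coframe e 2 + B • coframe e 3) (coframe e 4)
      + wedge (A • coframe e 0 - B • coframe e 1) (coframe e 5)
      + wedge (B • coframe e 0 + A • coframe e 1) (-B • coframe e 2 + A • coframe e 3)}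

/-- The set `𝒮'` of the forms
`(A e^3 + B e^4) ∧ e^5 + (A e^1 - B e^2) ∧ e^6 - (B e^1 + A e^2) ∧ (-B e^3 + A e^4)` with
`A^2 + B^2 = 1`. -/
def circleS' (e : Basis (Fin 6) ℝ L) : Set (LinearMap.BilinForm ℝ L) :=
  {ω | ∃ A B : ℝ, A ^ 2 + B ^ 2 = 1 ∧
    ω = wedge (A • coframe e 2 + B • coframe e 3) (coframe e 4)
      + wedge (A • coframe e 0 - B • coframe e 1) (coframe e 5)
      - wedge (B • coframe e 0 + A • coframe e 1) (-B • coframe e 2 + A • coframe e 3)}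

/-- A set of `2`-forms is a (topological) circle if it is the image of a continuous injective map
from the unit circle; continuity means that of all coefficients. -/
def IsCircle (S : Set (LinearMap.BilinForm ℝ L)) : Prop :=
  ∃ γ : Circle → LinearMap.BilinForm ℝ L,
    Function.Injective γ ∧ (∀ X Y, Continuous fun z => γ z X Y) ∧ Set.range γ = S

end Defs

end NilHermitian

open NilHermitian

namespace NilHermitian

/-! ### The covariant derivative of `ω` through the structure equations -/

section Basics

variable {L : Type*} [LieRing L] [LieAlgebra ℝ L]

/-! The Gray–Hervella components are read off from the involution `twist`, which sends `α(X, Y, Z)`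
to `α(JX, JY, Z)`. It is `-1` on `𝒲₁ ⊕ 𝒲₂` and `+1` on `𝒲₃ ⊕ 𝒲₄`; the cyclic sum separates `𝒲₁` from
`𝒲₂`, and the trace separates `𝒲₃` from `𝒲₄`. For `α = ∇ω` the `-1` part comes from the Nijenhuis
tensor (`covDeriv_sub_twist`), the cyclic sum is `dω` (`covDeriv_cyclic`), and the trace is `ω(e₁,
e₂) e⁵ + (ω(e₁, e₄) + ω(e₂, e₃)) e⁶` up to sign (`covDeriv_trace`).

This gives the inclusions `⊇`: the four isolated points of `𝒵₁₃₄` are integrable, the forms of `𝒮`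
are closed, and the points listed in `𝒵₁₂₃` have vanishing trace (`mem_Z123`).

For the reverse inclusions `J` becomes a skew matrix `a` with `a² = -1` and positive Pfaffian, which
equals its Pfaffian adjugate (`IsComplexMatrix.duality`). The entry `c = a 4 5`, that is `ω(e₅,
e₆)`, organizes the argument. Without a `𝒲₂` component the Nijenhuis tensor is totally skew, which
forces `c² = 1`: then `J` preserves `⟨e₅, e₆⟩`, is self-dual or anti-self-dual on `⟨e₁, …, e₄⟩`, and
the remaining equations have four solutions. Without a `𝒲₃` component either `c = 0`, which leads to
`𝒮`, or `c² = 1`, which is contradictory. -/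

theorem coframe_basis (e : Basis (Fin 6) ℝ L) (i j : Fin 6) :
    coframe e i (e j) = if j = i then 1 else 0 := by
  simp [coframe, Finsupp.single_apply]

theorem metric_apply (e : Basis (Fin 6) ℝ L) (X Y : L) :
    metric e X Y = ∑ i, coframe e i X * coframe e i Y := by
  simp [metric]

theorem eq_of_coframe (e : Basis (Fin 6) ℝ L) {X Y : L}
    (h : ∀ i, coframe e i X = coframe e i Y) : X = Y :=
  e.ext_elem fun i => by simpa [coframe] using h i

theorem wedge_apply (α β : Dual ℝ L) (X Y : L) : wedge α β X Y = α X * β Y - β X * α Y := by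
  simp [wedge]

theorem cf2_apply (e : Basis (Fin 6) ℝ L) (i j : Fin 6) (X Y : L) :
    cf2 e i j X Y = coframe e i X * coframe e j Y - coframe e j X * coframe e i Y := by
  simp [cf2, wedge_apply]

/-- The Lie bracket in terms of the structure equations. -/
theorem metric_lie {e : Basis (Fin 6) ℝ L} (he : StructureEquations e) (X Y Z : L) :
    metric e ⁅X, Y⁆ Z = -(cf2 e 0 1 X Y * coframe e 4 Z
      + (cf2 e 0 3 X Y + cf2 e 1 2 X Y) * coframe e 5 Z) := by
  have h : ∀ i : Fin 6, i < 4 → coframe e i ⁅X, Y⁆ = 0 := fun i hi => by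
    simpa [extD] using LinearMap.congr_fun₂ (he.closed i hi) X Y
  have h4 : coframe e 4 ⁅X, Y⁆ = -cf2 e 0 1 X Y := by
    rw [← he.d_five]; simp [extD]
  have h5 : coframe e 5 ⁅X, Y⁆ = -(cf2 e 0 3 X Y + cf2 e 1 2 X Y) := by
    rw [← LinearMap.add_apply, ← LinearMap.add_apply, ← he.d_six]; simp [extD]
  rw [metric_apply, Fin.sum_univ_six, h 0 (by decide), h 1 (by decide), h 2 (by decide),
    h 3 (by decide), h4, h5]
  ring

/-- The right hand side of the Koszul formula. -/
noncomputable def koszul (e : Basis (Fin 6) ℝ L) (X Y Z : L) : ℝ :=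
  metric e ⁅X, Y⁆ Z - metric e ⁅Y, Z⁆ X + metric e ⁅Z, X⁆ Y

theorem metric_lie_skew (e : Basis (Fin 6) ℝ L) (X Y Z : L) :
    metric e ⁅X, Y⁆ Z = -metric e ⁅Y, X⁆ Z := by
  rw [← lie_skew X Y, map_neg, LinearMap.neg_apply]

/-- `koszul e X Y Z` is `2 g(∇_X Y, Z)`, so this is the compatibility of `∇` with the metric. -/
theorem koszul_swap (e : Basis (Fin 6) ℝ L) (X Y Z : L) :
    koszul e X Z Y = -koszul e X Y Z := by
  unfold koszul
  linarith [metric_lie_skew e X Y Z, metric_lie_skew e X Z Y, metric_lie_skew e Y Z X]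

theorem koszul_neg (e : Basis (Fin 6) ℝ L) (X Y Z : L) :
    koszul e X Y (-Z) = -koszul e X Y Z := by
  simp only [koszul, lie_neg, neg_lie, map_neg, LinearMap.neg_apply]; ring

section Compatible

variable {e : Basis (Fin 6) ℝ L} {J : Module.End ℝ L} (hJ : IsCompatible e J)
include hJ

theorem IsCompatible.metric_left (X Y : L) : metric e (J X) Y = -metric e X (J Y) := by
  have h := hJ.orthogonal X (J Y)
  rw [hJ.sq, map_neg] at h
  linarith

theorem IsCompatible.metric_self (X : L) : metric e X (J X) = 0 := by
  have h := hJ.metric_left X X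
  rw [metric_comm] at h
  linarith

theorem IsCompatible.coframe_skew (i j : Fin 6) :
    coframe e i (J (e j)) = -coframe e j (J (e i)) := by
  rw [← metric_basis, ← metric_basis, hJ.metric_left, metric_comm]

end Compatible

theorem covDeriv_apply (e : Basis (Fin 6) ℝ L) (ω : LinearMap.BilinForm ℝ L) (X Y Z : L) :
    covDeriv e ω X Y Z = -ω (leviCivita e X Y) Z - ω Y (leviCivita e X Z) := by
  simp [covDeriv]

theorem covDeriv_koszul {e : Basis (Fin 6) ℝ L} {J : Module.End ℝ L} (hJ : IsCompatible e J)
    (X Y Z : L) :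
    2 * covDeriv e (fundamentalForm e J) X Y Z = koszul e X Y (J Z) - koszul e X Z (J Y) := by
  have h1 := metric_leviCivita e X Y (J Z)
  have h2 := metric_leviCivita e X Z (J Y)
  rw [covDeriv_apply]
  simp only [fundamentalForm, LinearMap.comp_apply, hJ.metric_left]
  have h3 := hJ.metric_left (leviCivita e X Z) Y
  rw [metric_comm e _ Y] at h3
  unfold koszul
  linarith

theorem covDeriv_mem_ghSpace {e : Basis (Fin 6) ℝ L} {J : Module.End ℝ L}
    (hJ : IsCompatible e J) : covDeriv e (fundamentalForm e J) ∈ ghSpace J := by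
  intro X Y Z
  have h1 := covDeriv_koszul hJ X Y Z
  have h2 := covDeriv_koszul hJ X Z Y
  have h3 := covDeriv_koszul hJ X (J Y) (J Z)
  simp only [hJ.sq, koszul_neg] at h3
  have h4 := koszul_swap e X (J Y) Z
  have h5 := koszul_swap e X (J Z) Y
  constructor <;> linarith

end Basics

/-! ### Decomposition of tensors -/

section Decomposition

variable {L : Type*} [LieRing L] [LieAlgebra ℝ L]

/-- The tensor `α(JX, JY, Z)`. -/
def twist (J : Module.End ℝ L) (α : Tensor3 L) : Tensor3 L where
  toFun X := α (J X) ∘ₗ J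
  map_add' X X' := by ext Y Z; simp
  map_smul' c X := by ext Y Z; simp

@[simp] theorem twist_apply (J : Module.End ℝ L) (α : Tensor3 L) (X Y Z : L) :
    twist J α X Y Z = α (J X) (J Y) Z := rfl

/-- The cyclic sum of a tensor that is skew in its last two arguments. -/
def cyclicSum (α : Tensor3 L) : Tensor3 L where
  toFun X := α X - α.flip X + (α.flip X).flip
  map_add' X X' := by ext Y Z; simp; ring
  map_smul' c X := by ext Y Z; simp; ring

theorem cyclicSum_apply (α : Tensor3 L) (X Y Z : L) :
    cyclicSum α X Y Z = α X Y Z - α Y X Z + α Z X Y := by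
  simp [cyclicSum, LinearMap.flip_apply]

/-- The tensor in `𝒲₄` determined by a `1`-form. -/
noncomputable def leeTensor (e : Basis (Fin 6) ℝ L) (J : Module.End ℝ L) (θ : Dual ℝ L) :
    Tensor3 L where
  toFun X := wedge (metric e X) θ - wedge (metric e X ∘ₗ J) (θ ∘ₗ J)
  map_add' X X' := by ext Y Z; simp [wedge_apply]; ring
  map_smul' c X := by ext Y Z; simp [wedge_apply]; ring

theorem leeTensor_apply (e : Basis (Fin 6) ℝ L) (J : Module.End ℝ L) (θ : Dual ℝ L) (X Y Z : L) :
    leeTensor e J θ X Y Z = metric e X Y * θ Z - metric e X Z * θ Y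
      - metric e X (J Y) * θ (J Z) + metric e X (J Z) * θ (J Y) := by
  simp [leeTensor, wedge_apply]; ring

variable {e : Basis (Fin 6) ℝ L} {J : Module.End ℝ L}

theorem ghSpace_swap {α : Tensor3 L} (hα : α ∈ ghSpace J) (X Y Z : L) :
    α X Y Z = -α X Z Y := (hα X Y Z).1

theorem ghSpace_J {α : Tensor3 L} (hα : α ∈ ghSpace J) (X Y Z : L) :
    α X (J Y) (J Z) = -α X Y Z := (hα X Y Z).2

/-- The arguments of a totally skew tensor can be permuted, so the type condition on the last two
arguments holds for any two. -/
theorem twist_of_mem_ghW1 {α : Tensor3 L} (hα : α ∈ ghW1 J) (X Y Z : L) :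
    α (J X) (J Y) Z = -α X Y Z := by
  have sk : ∀ X Y Z, α X Y Z = -α Y X Z := fun X Y Z => by
    have h := hα.2 (X + Y) Z
    simp only [map_add, LinearMap.add_apply, hα.2] at h
    linarith
  have h1 := ghSpace_J hα.1 Z X Y
  linarith [sk (J X) (J Y) Z, sk Z (J X) (J Y), ghSpace_swap hα.1 (J Y) Z (J X),
    sk (J X) Z (J Y), ghSpace_swap hα.1 (J X) Z (J Y), ghSpace_swap hα.1 X Z Y, sk X Z Y]

section

variable (hJ : IsCompatible e J)
include hJ

theorem ghSpace_J_left {α : Tensor3 L} (hα : α ∈ ghSpace J) (X Y Z : L) :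
    α X (J Y) Z = α X Y (J Z) := by
  have h := ghSpace_J hα X Y (J Z)
  rw [hJ.sq, map_neg] at h
  linarith

theorem twist_mem {α : Tensor3 L} (hα : α ∈ ghSpace J) : twist J α ∈ ghSpace J := by
  intro X Y Z
  have h1 := ghSpace_J_left hJ hα (J X) Y Z
  have h2 := ghSpace_swap hα (J X) (J Z) Y
  simp only [twist_apply, hJ.sq, map_neg, LinearMap.neg_apply]
  exact ⟨by linarith, by linarith⟩

theorem leeTensor_mem (θ : Dual ℝ L) : leeTensor e J θ ∈ ghW4 e J := by
  refine ⟨fun X Y Z => ?_, θ, leeTensor_apply e J θ⟩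
  simp only [leeTensor_apply, hJ.sq, map_neg]
  constructor <;> ring

theorem leeTensor_twist (θ : Dual ℝ L) (X Y Z : L) :
    leeTensor e J θ (J X) (J Y) Z = leeTensor e J θ X Y Z := by
  simp only [leeTensor_apply, hJ.sq, map_neg, hJ.orthogonal, hJ.metric_left]
  ring

/-- A trace is the same in every orthonormal basis, and `J` carries `e` to another one. -/
theorem sum_orthogonal (f : LinearMap.BilinForm ℝ L) :
    ∑ i, f (J (e i)) (J (e i)) = ∑ i, f (e i) (e i) := by
  have hexp : ∀ X : L, X = ∑ i, coframe e i X • e i := fun X => (e.sum_repr X).symm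
  have h : ∀ i, f (J (e i)) (J (e i))
      = ∑ j, ∑ k, coframe e i (J (e j)) * coframe e i (J (e k)) * f (e j) (e k) := fun i => by
    conv_lhs => rw [hexp (J (e i))]
    simp only [map_sum, map_smul, LinearMap.sum_apply, LinearMap.smul_apply, smul_eq_mul,
      hJ.coframe_skew _ i, Finset.mul_sum]
    rw [Finset.sum_comm]
    refine Finset.sum_congr rfl fun j _ => Finset.sum_congr rfl fun k _ => ?_
    ring
  simp only [h]
  rw [Finset.sum_comm]
  refine Finset.sum_congr rfl fun j _ => ?_
  rw [Finset.sum_comm]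
  simp only [← Finset.sum_mul, ← metric_apply, hJ.orthogonal, metric_basis, coframe_basis]
  simp

/-- The factor is `4 = 6 - 1 - 1`: the first term contributes the dimension, the second and the
fourth contribute `-θ Z` each, and the third vanishes as `g(X, JX) = 0`. -/
theorem leeTensor_trace (θ : Dual ℝ L) (Z : L) :
    ∑ i, leeTensor e J θ (e i) (e i) Z = 4 * θ Z := by
  have hexp : ∀ X : L, ∑ i, coframe e i X • e i = X := fun X => e.sum_repr X
  have h1 : ∑ i, metric e (e i) Z * θ (e i) = θ Z := by
    conv_rhs => rw [← hexp Z]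
    simp [metric_comm e _ Z, metric_basis]
  have h2 : ∑ i, metric e (e i) (J Z) * θ (J (e i)) = -θ Z := by
    rw [← map_neg, ← hJ.sq]
    conv_rhs => rw [← hexp (J Z)]
    simp [metric_comm e _ (J Z), metric_basis]
  simp only [leeTensor_apply, Finset.sum_add_distrib, Finset.sum_sub_distrib, h1, h2,
    hJ.metric_self, metric_basis, coframe_basis]
  simp
  ring

/-- A tensor in `𝒲` that is invariant under `J` in its first two arguments lies in `𝒲₃ ⊕ 𝒲₄`. -/
theorem mem_sup_of_twist_eq {α : Tensor3 L} (hα : α ∈ ghSpace J)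
    (h : ∀ X Y Z, α (J X) (J Y) Z = α X Y Z) : α ∈ ghW3 e J ⊔ ghW4 e J := by
  -- By `leeTensor_trace`, a quarter of the trace is the `1`-form whose `leeTensor` has the same
  -- trace as `α`.
  let θ : Dual ℝ L := (1 / 4 : ℝ) • ∑ i, α (e i) (e i)
  have hθ : ∀ Z, θ Z = (1 / 4 : ℝ) * ∑ i, α (e i) (e i) Z := fun Z => by simp [θ]
  rw [Submodule.mem_sup]
  refine ⟨α + (-1 : ℝ) • leeTensor e J θ,
    ⟨add_mem hα (Submodule.smul_mem _ _ (leeTensor_mem hJ θ).1), fun X Y Z => ?_, fun Z => ?_⟩,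
    _, leeTensor_mem hJ θ, by ext X Y Z; simp⟩
  · simp [h, leeTensor_twist hJ]
  · simp only [LinearMap.add_apply, LinearMap.smul_apply, smul_eq_mul, Finset.sum_add_distrib,
      ← Finset.mul_sum, leeTensor_trace hJ, hθ]
    ring

/-- A trace-free tensor in `𝒲` lies in `𝒲₁ ⊕ 𝒲₂ ⊕ 𝒲₃`. -/
theorem mem_sup_of_trace_eq_zero {α : Tensor3 L} (hα : α ∈ ghSpace J)
    (h : ∀ Z, ∑ i, α (e i) (e i) Z = 0) : α ∈ ghW1 J ⊔ ghW2 J ⊔ ghW3 e J := by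
  have ht : ∀ Z, ∑ i, α (J (e i)) (J (e i)) Z = 0 := fun Z => by
    simpa [h] using sum_orthogonal hJ ((LinearMap.flip (LinearMap.lflip.toLinearMap ∘ₗ α)) Z)
  -- `μ` and `ν` are the components of `α` in the eigenspaces `-1` and `+1` of `twist`.
  set μ : Tensor3 L := (1 / 2 : ℝ) • (α + (-1 : ℝ) • twist J α) with hμ
  set ν : Tensor3 L := (1 / 2 : ℝ) • (α + twist J α) with hν
  have hμα : ∀ X Y Z, μ X Y Z = 1 / 2 * (α X Y Z - α (J X) (J Y) Z) :=
    fun X Y Z => by simp [hμ]; ring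
  have hνα : ∀ X Y Z, ν X Y Z = 1 / 2 * (α X Y Z + α (J X) (J Y) Z) :=
    fun X Y Z => by simp [hν]; ring
  have hμ' : μ ∈ ghSpace J :=
    Submodule.smul_mem _ _ (add_mem hα (Submodule.smul_mem _ _ (twist_mem hJ hα)))
  have hν' : ν ∈ ghSpace J := Submodule.smul_mem _ _ (add_mem hα (twist_mem hJ hα))
  have hμJ : ∀ X Y Z, μ (J X) (J Y) Z = -μ X Y Z := fun X Y Z => by
    simp only [hμα, hJ.sq, map_neg, LinearMap.neg_apply]; ring
  -- The cyclic sum is multiplication by `3` on `𝒲₁` and zero on `𝒲₂`, so a third of it projects `μ`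
  -- to `𝒲₁`.
  set κ : Tensor3 L := (1 / 3 : ℝ) • cyclicSum μ with hκ
  have hκμ : ∀ X Y Z, κ X Y Z = 1 / 3 * (μ X Y Z + μ Y Z X + μ Z X Y) := fun X Y Z => by
    simp [hκ, cyclicSum_apply, ghSpace_swap hμ' Y Z X]; ring
  have hκ1 : κ ∈ ghW1 J := by
    refine ⟨fun X Y Z => ⟨?_, ?_⟩, fun X Z => ?_⟩
    · rw [hκμ, hκμ]
      linarith [ghSpace_swap hμ' X Y Z, ghSpace_swap hμ' Y Z X, ghSpace_swap hμ' Z X Y]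
    · rw [hκμ, hκμ]
      have h1 := ghSpace_J hμ' X Y Z
      have h2 := hμJ Y Z X
      have h2' := ghSpace_swap hμ' (J Y) (J Z) X
      have h3 := hμJ Z Y X
      have h3' := ghSpace_swap hμ' (J Z) X (J Y)
      have h4 := ghSpace_swap hμ' Z X Y
      linarith
    · rw [hκμ]
      have h1 := ghSpace_swap hμ' X X Z
      have h2 := ghSpace_swap hμ' Z X X
      linarith
  have hκ2 : μ + (-1 : ℝ) • κ ∈ ghW2 J := by
    refine ⟨add_mem hμ' (Submodule.smul_mem _ _ hκ1.1), fun X Y Z => ?_⟩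
    simp only [LinearMap.add_apply, LinearMap.smul_apply, smul_eq_mul, hκμ]
    ring
  have hν3 : ν ∈ ghW3 e J := by
    refine ⟨hν', fun X Y Z => ?_, fun Z => ?_⟩
    · simp only [hνα, hJ.sq, map_neg, LinearMap.neg_apply]; ring
    · simp only [hνα, ← Finset.mul_sum, Finset.sum_add_distrib, h, ht]; simp
  have : α = κ + (μ + (-1 : ℝ) • κ) + ν := by
    ext X Y Z
    simp only [LinearMap.add_apply, LinearMap.smul_apply, smul_eq_mul, hμα, hνα]; ring
  rw [this]
  exact add_mem (Submodule.mem_sup_left (add_mem (Submodule.mem_sup_left hκ1)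
    (Submodule.mem_sup_right hκ2))) (Submodule.mem_sup_right hν3)

/-- The tensors in `𝒲₁ ⊕ 𝒲₃ ⊕ 𝒲₄`. -/
theorem twist_diagonal_of_mem {α : Tensor3 L} (hα : α ∈ ghW1 J ⊔ ghW3 e J ⊔ ghW4 e J) (X Z : L) :
    α (J X) (J X) Z = α X X Z := by
  obtain ⟨σ, hσ, τ, ⟨hτ, θ, hθ⟩, rfl⟩ := Submodule.mem_sup.1 hα
  obtain ⟨κ, hκ, ν, hν, rfl⟩ := Submodule.mem_sup.1 hσ
  have hτ' : τ = leeTensor e J θ := by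
    ext X Y Z; rw [hθ, leeTensor_apply]
  -- The `𝒲₁` part vanishes on both sides by skewness; the other two parts are `twist`-invariant.
  simp [hκ.2, hν.2.1, hτ', leeTensor_twist hJ]

/-- The invariant part `α + twist J α` is symmetric in its first two arguments, by the cyclic
identity, and skew in its last two. Such a tensor is zero. -/
theorem twist_of_mem_ghW2 {α : Tensor3 L} (hα : α ∈ ghW2 J) (X Y Z : L) :
    α (J X) (J Y) Z = -α X Y Z := by
  have sym : ∀ X Y Z, α X Y Z + α (J X) (J Y) Z = α Y X Z + α (J Y) (J X) Z := fun X Y Z => by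
    linarith [hα.2 X Y Z, hα.2 (J X) (J Y) Z, ghSpace_J hα.1 Z X Y, ghSpace_swap hα.1 Y Z X,
      ghSpace_swap hα.1 (J Y) Z (J X)]
  have sk : ∀ X Y Z, α X Y Z + α (J X) (J Y) Z = -(α X Z Y + α (J X) (J Z) Y) := fun X Y Z => by
    linarith [ghSpace_swap hα.1 X Y Z, ghSpace_swap hα.1 (J X) Y (J Z),
      ghSpace_J_left hJ hα.1 (J X) Y Z]
  linarith [sym X Y Z, sk Y X Z, sym Y Z X, sk Z Y X, sym Z X Y, sk X Z Y]

/-- The tensors in `𝒲₁ ⊕ 𝒲₂ ⊕ 𝒲₄`. -/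
theorem twist_add_of_mem {α : Tensor3 L} (hα : α ∈ ghW1 J ⊔ ghW2 J ⊔ ghW4 e J) :
    ∃ θ : Dual ℝ L, (∀ Z, ∑ i, α (e i) (e i) Z = 4 * θ Z) ∧
      ∀ X Y Z, α X Y Z + α (J X) (J Y) Z = 2 * leeTensor e J θ X Y Z := by
  obtain ⟨σ, hσ, τ, ⟨hτ, θ, hθ⟩, rfl⟩ := Submodule.mem_sup.1 hα
  obtain ⟨κ, hκ, ν, hν, rfl⟩ := Submodule.mem_sup.1 hσ
  have hτ' : τ = leeTensor e J θ := by
    ext X Y Z; rw [hθ, leeTensor_apply]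
  have key : ∀ X Y Z, (κ + ν + τ) X Y Z + (κ + ν + τ) (J X) (J Y) Z
      = 2 * leeTensor e J θ X Y Z := fun X Y Z => by
    simp only [LinearMap.add_apply, twist_of_mem_ghW1 hκ, twist_of_mem_ghW2 hJ hν, hτ',
      leeTensor_twist hJ]
    ring
  refine ⟨θ, fun Z => ?_, key⟩
  -- Tracing `key` identifies `θ`: both terms on its left have the same trace because `J` is
  -- orthogonal.
  have h1 := sum_orthogonal hJ
    ((LinearMap.flip (LinearMap.lflip.toLinearMap ∘ₗ (κ + ν + τ))) Z)
  have h2 := Finset.sum_congr rfl fun i (_ : i ∈ Finset.univ) => key (e i) (e i) Z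
  rw [Finset.sum_add_distrib, ← Finset.mul_sum, leeTensor_trace hJ] at h2
  have h3 : ∑ i, (κ + ν + τ) (J (e i)) (J (e i)) Z = ∑ i, (κ + ν + τ) (e i) (e i) Z := h1
  linarith

end

end Decomposition

/-! ### Matrices of compatible almost complex structures -/

/-- The Pfaffian of a skew `6 × 6` matrix. -/
def pfaffian6 (a : Fin 6 → Fin 6 → ℝ) : ℝ :=
  a 0 1 * (a 2 3 * a 4 5 - a 2 4 * a 3 5 + a 2 5 * a 3 4)
    - a 0 2 * (a 1 3 * a 4 5 - a 1 4 * a 3 5 + a 1 5 * a 3 4)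
    + a 0 3 * (a 1 2 * a 4 5 - a 1 4 * a 2 5 + a 1 5 * a 2 4)
    - a 0 4 * (a 1 2 * a 3 5 - a 1 3 * a 2 5 + a 1 5 * a 2 3)
    + a 0 5 * (a 1 2 * a 3 4 - a 1 3 * a 2 4 + a 1 4 * a 2 3)

/-- The matrix of an orthogonal complex structure compatible with the standard orientation. -/
structure IsComplexMatrix (a : Fin 6 → Fin 6 → ℝ) : Prop where
  skew : ∀ i j, a i j = -a j i
  sq : ∀ i j, ∑ k, a i k * a k j = if i = j then -1 else 0
  oriented : 0 < pfaffian6 a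

theorem IsComplexMatrix.diag {a : Fin 6 → Fin 6 → ℝ} (ha : IsComplexMatrix a) (i : Fin 6) :
    a i i = 0 := by
  linarith [ha.skew i i]

theorem IsComplexMatrix.row {a : Fin 6 → Fin 6 → ℝ} (ha : IsComplexMatrix a) (i : Fin 6) :
    ∑ k, a i k ^ 2 = 1 := by
  have h := ha.sq i i
  rw [if_pos rfl] at h
  rw [← neg_inj, ← h, ← Finset.sum_neg_distrib]
  exact Finset.sum_congr rfl fun k _ => by rw [ha.skew k i]; ring

/-- Turns identities between skew matrices into polynomial identities in the fifteen entries above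
the diagonal. -/
theorem skew_eq_of (a : Matrix (Fin 6) (Fin 6) ℝ) (h : ∀ i j, a i j = -a j i) :
    a = !![0, a 0 1, a 0 2, a 0 3, a 0 4, a 0 5;
      -a 0 1, 0, a 1 2, a 1 3, a 1 4, a 1 5;
      -a 0 2, -a 1 2, 0, a 2 3, a 2 4, a 2 5;
      -a 0 3, -a 1 3, -a 2 3, 0, a 3 4, a 3 5;
      -a 0 4, -a 1 4, -a 2 4, -a 3 4, 0, a 4 5;
      -a 0 5, -a 1 5, -a 2 5, -a 3 5, -a 4 5, 0] := by
  have hd : ∀ i, a i i = 0 := fun i => by linarith [h i i]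
  ext i j
  fin_cases i <;> fin_cases j <;> simp [hd] <;> exact h _ _

/-- The adjugate of a skew matrix with respect to its Pfaffian. -/
def pfaffianAdj (a : Fin 6 → Fin 6 → ℝ) : Matrix (Fin 6) (Fin 6) ℝ :=
  !![0,
      a 2 3 * a 4 5 - a 2 4 * a 3 5 + a 2 5 * a 3 4,
      -(a 1 3 * a 4 5) + a 1 4 * a 3 5 - a 1 5 * a 3 4,
      a 1 2 * a 4 5 - a 1 4 * a 2 5 + a 1 5 * a 2 4,
      -(a 1 2 * a 3 5) + a 1 3 * a 2 5 - a 1 5 * a 2 3,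
      a 1 2 * a 3 4 - a 1 3 * a 2 4 + a 1 4 * a 2 3;
    -(a 2 3 * a 4 5 - a 2 4 * a 3 5 + a 2 5 * a 3 4),
      0,
      a 0 3 * a 4 5 - a 0 4 * a 3 5 + a 0 5 * a 3 4,
      -(a 0 2 * a 4 5) + a 0 4 * a 2 5 - a 0 5 * a 2 4,
      a 0 2 * a 3 5 - a 0 3 * a 2 5 + a 0 5 * a 2 3,
      -(a 0 2 * a 3 4) + a 0 3 * a 2 4 - a 0 4 * a 2 3;
    -(-(a 1 3 * a 4 5) + a 1 4 * a 3 5 - a 1 5 * a 3 4),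
      -(a 0 3 * a 4 5 - a 0 4 * a 3 5 + a 0 5 * a 3 4),
      0,
      a 0 1 * a 4 5 - a 0 4 * a 1 5 + a 0 5 * a 1 4,
      -(a 0 1 * a 3 5) + a 0 3 * a 1 5 - a 0 5 * a 1 3,
      a 0 1 * a 3 4 - a 0 3 * a 1 4 + a 0 4 * a 1 3;
    -(a 1 2 * a 4 5 - a 1 4 * a 2 5 + a 1 5 * a 2 4),
      -(-(a 0 2 * a 4 5) + a 0 4 * a 2 5 - a 0 5 * a 2 4),
      -(a 0 1 * a 4 5 - a 0 4 * a 1 5 + a 0 5 * a 1 4),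
      0,
      a 0 1 * a 2 5 - a 0 2 * a 1 5 + a 0 5 * a 1 2,
      -(a 0 1 * a 2 4) + a 0 2 * a 1 4 - a 0 4 * a 1 2;
    -(-(a 1 2 * a 3 5) + a 1 3 * a 2 5 - a 1 5 * a 2 3),
      -(a 0 2 * a 3 5 - a 0 3 * a 2 5 + a 0 5 * a 2 3),
      -(-(a 0 1 * a 3 5) + a 0 3 * a 1 5 - a 0 5 * a 1 3),
      -(a 0 1 * a 2 5 - a 0 2 * a 1 5 + a 0 5 * a 1 2),
      0,
      a 0 1 * a 2 3 - a 0 2 * a 1 3 + a 0 3 * a 1 2;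
    -(a 1 2 * a 3 4 - a 1 3 * a 2 4 + a 1 4 * a 2 3),
      -(-(a 0 2 * a 3 4) + a 0 3 * a 2 4 - a 0 4 * a 2 3),
      -(a 0 1 * a 3 4 - a 0 3 * a 1 4 + a 0 4 * a 1 3),
      -(-(a 0 1 * a 2 4) + a 0 2 * a 1 4 - a 0 4 * a 1 2),
      -(a 0 1 * a 2 3 - a 0 2 * a 1 3 + a 0 3 * a 1 2),
      0]

theorem mul_pfaffianAdj (a : Matrix (Fin 6) (Fin 6) ℝ) (h : ∀ i j, a i j = -a j i) :
    a * pfaffianAdj a = -pfaffian6 a • (1 : Matrix (Fin 6) (Fin 6) ℝ) := by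
  rw [skew_eq_of a h]
  ext i j
  fin_cases i <;> fin_cases j <;>
    simp [Matrix.mul_apply, Fin.sum_univ_six, pfaffianAdj, pfaffian6] <;> ring

/-- One row suffices, as a row of a complex matrix has norm one. `pfaffianAdj` reads only entries
above the diagonal, so skewness is not needed, and `a 0 0` has to be excluded. -/
theorem pfaffianAdj_pfaffianAdj (a : Matrix (Fin 6) (Fin 6) ℝ) (j : Fin 6) :
    pfaffianAdj (pfaffianAdj a) 0 j = pfaffian6 a * if j = 0 then 0 else a 0 j := by
  fin_cases j <;> simp [pfaffianAdj, pfaffian6] <;> ring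

theorem pfaffianAdj_smul (a : Matrix (Fin 6) (Fin 6) ℝ) (c : ℝ) (i j : Fin 6) :
    pfaffianAdj (c • a) i j = c ^ 2 * pfaffianAdj a i j := by
  fin_cases i <;> fin_cases j <;> simp [pfaffianAdj] <;> ring

/-- A compatible complex structure is its own Hodge dual: it equals its Pfaffian adjugate. -/
theorem IsComplexMatrix.pfaffianAdj_eq {a : Fin 6 → Fin 6 → ℝ} (ha : IsComplexMatrix a)
    (i j : Fin 6) : pfaffianAdj a i j = a i j := by
  let A : Matrix (Fin 6) (Fin 6) ℝ := a
  have hsq : A * A = -1 := by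
    ext i j
    rw [Matrix.mul_apply, ha.sq, Matrix.neg_apply, Matrix.one_apply]
    split_ifs <;> simp
  -- Multiply `a * pfaffianAdj a = -Pf(a)` by `a` and use `a² = -1`.
  have hP : pfaffianAdj a = pfaffian6 a • A := by
    have h : A * (A * pfaffianAdj a) = A * (-pfaffian6 a • (1 : Matrix (Fin 6) (Fin 6) ℝ)) :=
      congrArg _ (mul_pfaffianAdj A ha.skew)
    rw [← mul_assoc, hsq] at h
    simpa using h
  -- The double adjugate computed in two ways: it is `Pf(a) a` in general, and `Pf(a)³ a` by `hP`,
  -- since the adjugate is quadratic.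
  have hrow : ∀ j, pfaffian6 a * a 0 j = pfaffian6 a ^ 3 * a 0 j := fun j => by
    have h := pfaffianAdj_pfaffianAdj A j
    rw [show pfaffianAdj A = pfaffian6 a • A from hP, pfaffianAdj_smul,
      show pfaffianAdj A = pfaffian6 a • A from hP] at h
    have hj : (if j = 0 then 0 else A 0 j) = a 0 j := by
      split_ifs with hj
      · rw [hj, ha.diag]
      · rfl
    rw [hj] at h
    have h' : pfaffian6 a ^ 2 * (pfaffian6 a * a 0 j) = pfaffian6 a * a 0 j := h
    linarith
  have h3 : pfaffian6 a = pfaffian6 a ^ 3 := by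
    have h := ha.row 0
    calc pfaffian6 a = pfaffian6 a * ∑ k, a 0 k ^ 2 := by rw [h, mul_one]
      _ = pfaffian6 a ^ 3 * ∑ k, a 0 k ^ 2 := by
          rw [Finset.mul_sum, Finset.mul_sum]
          exact Finset.sum_congr rfl fun k _ => by rw [pow_two, ← mul_assoc, hrow, mul_assoc]
      _ = pfaffian6 a ^ 3 := by rw [h, mul_one]
  have h1 : pfaffian6 a = 1 := by
    have hp := ha.oriented
    have : pfaffian6 a * ((pfaffian6 a - 1) * (pfaffian6 a + 1)) = 0 := by linear_combination -h3
    rcases mul_eq_zero.1 this with h | h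
    · exact absurd h hp.ne'
    · rcases mul_eq_zero.1 h with h | h <;> linarith
  rw [hP, h1, one_smul]

/-- The entries on the first four basis vectors are determined by the other ones. -/
theorem IsComplexMatrix.duality {a : Fin 6 → Fin 6 → ℝ} (ha : IsComplexMatrix a) :
    a 0 1 = a 2 3 * a 4 5 - a 2 4 * a 3 5 + a 2 5 * a 3 4 ∧
    a 0 2 = -(a 1 3 * a 4 5) + a 1 4 * a 3 5 - a 1 5 * a 3 4 ∧
    a 0 3 = a 1 2 * a 4 5 - a 1 4 * a 2 5 + a 1 5 * a 2 4 ∧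
    a 1 2 = a 0 3 * a 4 5 - a 0 4 * a 3 5 + a 0 5 * a 3 4 ∧
    a 1 3 = -(a 0 2 * a 4 5) + a 0 4 * a 2 5 - a 0 5 * a 2 4 ∧
    a 2 3 = a 0 1 * a 4 5 - a 0 4 * a 1 5 + a 0 5 * a 1 4 := by
  refine ⟨?_, ?_, ?_, ?_, ?_, ?_⟩
  · rw [← ha.pfaffianAdj_eq 0 1]; rfl
  · rw [← ha.pfaffianAdj_eq 0 2]; rfl
  · rw [← ha.pfaffianAdj_eq 0 3]; rfl
  · rw [← ha.pfaffianAdj_eq 1 2]; rfl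
  · rw [← ha.pfaffianAdj_eq 1 3]; rfl
  · rw [← ha.pfaffianAdj_eq 2 3]; rfl

/-! ### Almost complex structures as matrices; trace and cyclic sum of `∇ω` -/

section Entries

variable {L : Type*} [LieRing L] [LieAlgebra ℝ L]

theorem expand (e : Basis (Fin 6) ℝ L) (X : L) : X = ∑ i, coframe e i X • e i :=
  (e.sum_repr X).symm

theorem IsCompatible.isComplexMatrix {e : Basis (Fin 6) ℝ L} {J : Module.End ℝ L}
    (hJ : IsCompatible e J) : IsComplexMatrix fun i j => coframe e j (J (e i)) where
  skew i j := hJ.coframe_skew j i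
  sq i j := by
    have h := congrArg (coframe e j) (hJ.sq (e i))
    conv_lhs at h => rw [expand e (J (e i))]
    simpa [coframe_basis, apply_ite] using h
  oriented := by
    have h := hJ.oriented
    simp only [pfaffian, fundamentalForm, LinearMap.comp_apply, metric_basis] at h
    exact h

/-- The endomorphism with fundamental form `ω`. -/
noncomputable def endOfForm (e : Basis (Fin 6) ℝ L) (ω : LinearMap.BilinForm ℝ L) :
    Module.End ℝ L :=
  ∑ i, (ω.flip (e i)).smulRight (e i)

theorem coframe_endOfForm (e : Basis (Fin 6) ℝ L) (ω : LinearMap.BilinForm ℝ L) (X : L)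
    (i : Fin 6) : coframe e i (endOfForm e ω X) = ω X (e i) := by
  simp [endOfForm, coframe_basis]

theorem fundamentalForm_endOfForm (e : Basis (Fin 6) ℝ L) (ω : LinearMap.BilinForm ℝ L) :
    fundamentalForm e (endOfForm e ω) = ω := by
  refine LinearMap.ext fun X => e.ext fun i => ?_
  simp [fundamentalForm, metric_basis, coframe_endOfForm]

theorem isCompatible_endOfForm {e : Basis (Fin 6) ℝ L} {ω : LinearMap.BilinForm ℝ L}
    (h : IsComplexMatrix fun i j => ω (e i) (e j)) : IsCompatible e (endOfForm e ω) := by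
  have hsq : ∀ X, endOfForm e ω (endOfForm e ω X) = -X := fun X => by
    have : endOfForm e ω ∘ₗ endOfForm e ω = -LinearMap.id := e.ext fun i =>
      eq_of_coframe e fun j => by
        have hs := h.sq i j
        simp only [LinearMap.comp_apply, LinearMap.neg_apply, LinearMap.id_apply, map_neg,
          coframe_basis]
        conv_lhs => rw [expand e (endOfForm e ω (e i))]
        simpa [coframe_endOfForm, apply_ite] using hs
    exact LinearMap.congr_fun this X
  have hskew : ∀ X Y, ω X Y = -ω Y X := fun X Y => by
    have : ω = -ω.flip := e.ext fun i => e.ext fun j => h.skew i j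
    exact LinearMap.congr_fun₂ this X Y
  have hm : ∀ X Y, metric e (endOfForm e ω X) Y = ω X Y := fun X Y =>
    LinearMap.congr_fun₂ (fundamentalForm_endOfForm e ω) X Y
  refine ⟨hsq, fun X Y => ?_, ?_⟩
  · rw [hm, hskew, ← hm, hsq, map_neg, LinearMap.neg_apply, neg_neg, metric_comm]
  · rw [fundamentalForm_endOfForm]
    exact h.oriented

/-- The Lee form of `ω`, up to a factor. -/
theorem covDeriv_trace {e : Basis (Fin 6) ℝ L} (he : StructureEquations e)
    {J : Module.End ℝ L} (hJ : IsCompatible e J) (Z : L) :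
    ∑ i, covDeriv e (fundamentalForm e J) (e i) (e i) Z =
      -(coframe e 1 (J (e 0)) * coframe e 4 Z
        + (coframe e 3 (J (e 0)) + coframe e 2 (J (e 1))) * coframe e 5 Z) := by
  have hs := hJ.coframe_skew
  have h := Finset.sum_congr rfl fun i (_ : i ∈ Finset.univ) =>
    covDeriv_koszul hJ (e i) (e i) Z
  rw [← Finset.mul_sum] at h
  simp only [koszul, metric_lie he, cf2_apply, Fin.sum_univ_six, coframe_basis] at h
  simp at h
  rw [hs 0 1, hs 0 3, hs 0 4, hs 0 5, hs 1 2, hs 1 4, hs 1 5, hs 2 5, hs 3 5] at h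
  rw [Fin.sum_univ_six]
  linear_combination h / 2

/-- The cyclic sum of `∇ω` is `dω`. -/
theorem covDeriv_cyclic {e : Basis (Fin 6) ℝ L} {J : Module.End ℝ L} (hJ : IsCompatible e J)
    (X Y Z : L) :
    covDeriv e (fundamentalForm e J) X Y Z + covDeriv e (fundamentalForm e J) Y Z X
        + covDeriv e (fundamentalForm e J) Z X Y
      = metric e ⁅X, Y⁆ (J Z) + metric e ⁅Y, Z⁆ (J X) + metric e ⁅Z, X⁆ (J Y) := by
  have h1 := covDeriv_koszul hJ X Y Z
  have h2 := covDeriv_koszul hJ Y Z X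
  have h3 := covDeriv_koszul hJ Z X Y
  have sk := metric_lie_skew e
  unfold koszul at h1 h2 h3
  linarith [sk X Y (J Z), sk Y Z (J X), sk Z X (J Y), sk X (J Y) Z, sk X (J Z) Y, sk Y (J X) Z,
    sk Y (J Z) X, sk Z (J X) Y, sk Z (J Y) X]

/-- A form of which `dω` vanishes has its covariant derivative in `𝒲₂`. -/
theorem covDeriv_mem_ghW2 {e : Basis (Fin 6) ℝ L} {J : Module.End ℝ L} (hJ : IsCompatible e J)
    (h : ∀ X Y Z, metric e ⁅X, Y⁆ (J Z) + metric e ⁅Y, Z⁆ (J X) + metric e ⁅Z, X⁆ (J Y) = 0) :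
    covDeriv e (fundamentalForm e J) ∈ ghW2 J :=
  ⟨covDeriv_mem_ghSpace hJ, fun X Y Z => by rw [covDeriv_cyclic hJ, h]⟩

/-- The trace of `∇ω` decides whether it has a component in `𝒲₄`. -/
theorem mem_Z123 {e : Basis (Fin 6) ℝ L} (he : StructureEquations e)
    {ω : LinearMap.BilinForm ℝ L} (hω : ω ∈ spaceZ e) (h1 : ω (e 0) (e 1) = 0)
    (h2 : ω (e 0) (e 3) + ω (e 1) (e 2) = 0) : ω ∈ Z123 e := by
  obtain ⟨J, hJ, rfl⟩ := hω
  simp only [fundamentalForm, LinearMap.comp_apply, metric_basis] at h1 h2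
  exact ⟨J, hJ, rfl, mem_sup_of_trace_eq_zero hJ (covDeriv_mem_ghSpace hJ) fun Z => by
    rw [covDeriv_trace he hJ, h1, h2]; simp⟩

end Entries

/-! ### Points of `𝒵` -/

section Points

variable {L : Type*} [LieRing L] [LieAlgebra ℝ L]

theorem form_ext (e : Basis (Fin 6) ℝ L) {ω η : LinearMap.BilinForm ℝ L}
    (hω : ∀ i j, ω (e i) (e j) = -ω (e j) (e i)) (hη : ∀ i j, η (e i) (e j) = -η (e j) (e i))
    (h : ∀ i j, i < j → ω (e i) (e j) = η (e i) (e j)) : ω = η := by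
  refine e.ext fun i => e.ext fun j => ?_
  rcases lt_trichotomy i j with hij | rfl | hij
  · exact h i j hij
  · linarith [hω i i, hη i i]
  · rw [hω, hη, h j i hij]

theorem mem_spaceZ_iff (e : Basis (Fin 6) ℝ L) (ω : LinearMap.BilinForm ℝ L) :
    ω ∈ spaceZ e ↔ IsComplexMatrix fun i j => ω (e i) (e j) := by
  constructor
  · rintro ⟨J, hJ, rfl⟩
    simpa [fundamentalForm, metric_basis] using hJ.isComplexMatrix
  · exact fun h => ⟨_, isCompatible_endOfForm h, (fundamentalForm_endOfForm e ω).symm⟩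

/-- The `(3,0)`-part of `g([X, Y], Z)`, a form of the Nijenhuis tensor. -/
noncomputable def nijenhuis (e : Basis (Fin 6) ℝ L) (J : Module.End ℝ L) (X Y Z : L) : ℝ :=
  metric e ⁅J X, Y⁆ Z + metric e ⁅X, J Y⁆ Z + metric e ⁅X, Y⁆ (J Z) - metric e ⁅J X, J Y⁆ (J Z)

theorem covDeriv_sub_twist {e : Basis (Fin 6) ℝ L} {J : Module.End ℝ L} (hJ : IsCompatible e J)
    (X Y Z : L) :
    2 * (covDeriv e (fundamentalForm e J) X Y Z - covDeriv e (fundamentalForm e J) (J X) (J Y) Z)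
      = nijenhuis e J X Y Z - nijenhuis e J Y Z X + nijenhuis e J Z X Y := by
  have h1 := covDeriv_koszul hJ X Y Z
  have h2 := covDeriv_koszul hJ (J X) (J Y) Z
  rw [hJ.sq, koszul_neg, koszul_swap e (J X) Y Z] at h2
  have h3 := koszul_swap e X (J Y) Z
  unfold nijenhuis
  unfold koszul at h1 h2 h3
  linarith

/-- For an integrable structure `∇ω` is `twist`-invariant, so it lies in `𝒲₃ ⊕ 𝒲₄`, which is
contained in both sums. -/
theorem mem_of_nijenhuis_eq_zero {e : Basis (Fin 6) ℝ L} {J : Module.End ℝ L}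
    (hJ : IsCompatible e J) (h : ∀ X Y Z, nijenhuis e J X Y Z = 0) :
    fundamentalForm e J ∈ Z234 e ∧ fundamentalForm e J ∈ Z134 e := by
  have hm : covDeriv e (fundamentalForm e J) ∈ ghW3 e J ⊔ ghW4 e J :=
    mem_sup_of_twist_eq hJ (covDeriv_mem_ghSpace hJ) fun X Y Z => by
      linarith [covDeriv_sub_twist hJ X Y Z, h X Y Z, h Y Z X, h Z X Y]
  exact ⟨⟨J, hJ, rfl, sup_le_sup_right (c := ghW4 e J) le_sup_right hm⟩,
    ⟨J, hJ, rfl, sup_le_sup_right (c := ghW4 e J) le_sup_right hm⟩⟩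

/-- A structure with `J e₅ = c e₆` is integrable if `e⁵ + i c e⁶` has a closed differential
modulo the ideal of `(1,0)`-forms. -/
theorem nijenhuis_eq_zero {e : Basis (Fin 6) ℝ L} (he : StructureEquations e)
    {J : Module.End ℝ L} (c : ℝ) (h4 : ∀ X, coframe e 4 (J X) = -c * coframe e 5 X)
    (h5 : ∀ X, coframe e 5 (J X) = c * coframe e 4 X)
    (h1 : ∀ X Y, cf2 e 0 1 (J X) Y + cf2 e 0 1 X (J Y)
      + c * ((cf2 e 0 3 + cf2 e 1 2) X Y - (cf2 e 0 3 + cf2 e 1 2) (J X) (J Y)) = 0)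
    (h2 : ∀ X Y, (cf2 e 0 3 + cf2 e 1 2) (J X) Y + (cf2 e 0 3 + cf2 e 1 2) X (J Y)
      - c * (cf2 e 0 1 X Y - cf2 e 0 1 (J X) (J Y)) = 0) (X Y Z : L) :
    nijenhuis e J X Y Z = 0 := by
  have h1 := h1 X Y
  have h2 := h2 X Y
  simp only [LinearMap.add_apply] at h1 h2
  simp only [nijenhuis, metric_lie he, h4, h5]
  linear_combination -coframe e 4 Z * h1 - coframe e 5 Z * h2

theorem vertex1_mem_spaceZ (e : Basis (Fin 6) ℝ L) : vertex1 e ∈ spaceZ e := by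
  rw [mem_spaceZ_iff]
  refine ⟨fun i j => ?_, fun i j => ?_, ?_⟩
  · simp only [vertex1, LinearMap.sub_apply, cf2_apply]; ring
  · fin_cases i <;> fin_cases j <;>
      simp [vertex1, cf2_apply, coframe_basis]
  · simp [pfaffian6, vertex1, cf2_apply, coframe_basis]

theorem vertex2_mem_spaceZ (e : Basis (Fin 6) ℝ L) : vertex2 e ∈ spaceZ e := by
  rw [mem_spaceZ_iff]
  refine ⟨fun i j => ?_, fun i j => ?_, ?_⟩
  · simp only [vertex2, LinearMap.sub_apply, LinearMap.add_apply, LinearMap.neg_apply, cf2_apply]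
    ring
  · fin_cases i <;> fin_cases j <;>
      simp [vertex2, cf2_apply, coframe_basis]
  · simp [pfaffian6, vertex2, cf2_apply, coframe_basis]

theorem eps_mem_spaceZ (e : Basis (Fin 6) ℝ L) (θ : ℝ) : eps e θ ∈ spaceZ e := by
  rw [mem_spaceZ_iff]
  have h := Real.sin_sq_add_cos_sq θ
  refine ⟨fun i j => ?_, fun i j => ?_, ?_⟩
  · simp only [eps, LinearMap.add_apply, LinearMap.smul_apply, cf2_apply, smul_eq_mul]
    ring
  · fin_cases i <;> fin_cases j <;>
      simp [eps, cf2_apply, coframe_basis, Fin.sum_univ_six] <;> linarith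
  · simp [pfaffian6, eps, cf2_apply, coframe_basis]
    nlinarith

/-- The form of `𝒮` (for `s = 1`) or `𝒮'` (for `s = -1`) with parameters `A` and `B`. -/
noncomputable def circleForm (e : Basis (Fin 6) ℝ L) (s A B : ℝ) : LinearMap.BilinForm ℝ L :=
  -s • wedge (A • coframe e 2 + B • coframe e 3) (coframe e 4)
    + wedge (A • coframe e 0 - B • coframe e 1) (coframe e 5)
    + s • wedge (B • coframe e 0 + A • coframe e 1) (-B • coframe e 2 + A • coframe e 3)

theorem circleS_eq (e : Basis (Fin 6) ℝ L) :
    circleS e = {ω | ∃ A B : ℝ, A ^ 2 + B ^ 2 = 1 ∧ ω = circleForm e 1 A B} := by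
  have h : ∀ A B : ℝ, -wedge (A • coframe e 2 + B • coframe e 3) (coframe e 4)
      + wedge (A • coframe e 0 - B • coframe e 1) (coframe e 5)
      + wedge (B • coframe e 0 + A • coframe e 1) (-B • coframe e 2 + A • coframe e 3)
      = circleForm e 1 A B := fun A B => by ext X Y; simp [circleForm]
  simp only [circleS, h]

theorem circleS'_eq (e : Basis (Fin 6) ℝ L) :
    circleS' e = {ω | ∃ A B : ℝ, A ^ 2 + B ^ 2 = 1 ∧ ω = circleForm e (-1) A B} := by
  have h : ∀ A B : ℝ, wedge (A • coframe e 2 + B • coframe e 3) (coframe e 4)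
      + wedge (A • coframe e 0 - B • coframe e 1) (coframe e 5)
      - wedge (B • coframe e 0 + A • coframe e 1) (-B • coframe e 2 + A • coframe e 3)
      = circleForm e (-1) A B := fun A B => by ext X Y; simp [circleForm, sub_eq_add_neg]
  simp only [circleS', h]

theorem circleForm_apply (e : Basis (Fin 6) ℝ L) (s A B : ℝ) (X Y : L) :
    circleForm e s A B X Y =
      -s * (A * cf2 e 2 4 X Y + B * cf2 e 3 4 X Y) + A * cf2 e 0 5 X Y - B * cf2 e 1 5 X Y
      + s * (-B ^ 2 * cf2 e 0 2 X Y + A * B * cf2 e 0 3 X Y - A * B * cf2 e 1 2 X Y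
        + A ^ 2 * cf2 e 1 3 X Y) := by
  simp [circleForm, wedge_apply, cf2_apply]; ring

theorem circleForm_mem_spaceZ (e : Basis (Fin 6) ℝ L) {s A B : ℝ} (hs : s ^ 2 = 1)
    (h : A ^ 2 + B ^ 2 = 1) : circleForm e s A B ∈ spaceZ e := by
  rw [mem_spaceZ_iff]
  refine ⟨fun i j => ?_, fun i j => ?_, ?_⟩
  · simp only [circleForm_apply, cf2_apply]; ring
  · fin_cases i <;> fin_cases j <;>
      simp [circleForm_apply, cf2_apply, coframe_basis, Fin.sum_univ_six] <;> grind
  · have : pfaffian6 (fun i j => circleForm e s A B (e i) (e j)) = 1 := by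
      simp [pfaffian6, circleForm_apply, cf2_apply, coframe_basis]
      grind
    rw [this]; exact one_pos

theorem isCircle_circleForm (e : Basis (Fin 6) ℝ L) (s : ℝ) :
    IsCircle {ω | ∃ A B : ℝ, A ^ 2 + B ^ 2 = 1 ∧ ω = circleForm e s A B} := by
  refine ⟨fun z => circleForm e s (z : ℂ).re (z : ℂ).im, fun z w h => ?_, fun X Y => ?_, ?_⟩
  · have h1 := LinearMap.congr_fun₂ h (e 0) (e 5)
    have h2 := LinearMap.congr_fun₂ h (e 1) (e 5)
    simp [circleForm_apply, cf2_apply, coframe_basis] at h1 h2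
    exact Circle.ext (Complex.ext h1 h2)
  · simp only [circleForm_apply]
    fun_prop
  · ext ω
    constructor
    · rintro ⟨z, rfl⟩
      refine ⟨_, _, ?_, rfl⟩
      have h := Circle.normSq_coe z
      rw [Complex.normSq_apply] at h
      linarith
    · rintro ⟨A, B, h, rfl⟩
      refine ⟨⟨⟨A, B⟩, ?_⟩, rfl⟩
      rw [Submonoid.unitSphere, ← SetLike.mem_coe]
      refine mem_sphere_zero_iff_norm.2 ?_
      rw [← sq_eq_sq₀ (norm_nonneg _) zero_le_one, ← Complex.normSq_eq_norm_sq,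
        Complex.normSq_apply]
      simp only
      linarith

variable {e : Basis (Fin 6) ℝ L} (he : StructureEquations e)
include he

theorem vertex1_mem : vertex1 e ∈ Z234 e ∧ vertex1 e ∈ Z134 e := by
  have h := isCompatible_endOfForm ((mem_spaceZ_iff e _).1 (vertex1_mem_spaceZ e))
  rw [← fundamentalForm_endOfForm e (vertex1 e)]
  -- The constant `-1` is the coefficient of `e^{56}` in `ω₁`.
  refine mem_of_nijenhuis_eq_zero h (nijenhuis_eq_zero he (-1) ?_ ?_ ?_ ?_) <;> intros <;>
    simp [coframe_endOfForm, cf2_apply, vertex1, coframe_basis] <;> ring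

theorem vertex2_mem : vertex2 e ∈ Z234 e ∧ vertex2 e ∈ Z134 e := by
  have h := isCompatible_endOfForm ((mem_spaceZ_iff e _).1 (vertex2_mem_spaceZ e))
  rw [← fundamentalForm_endOfForm e (vertex2 e)]
  refine mem_of_nijenhuis_eq_zero h (nijenhuis_eq_zero he (-1) ?_ ?_ ?_ ?_) <;> intros <;>
    simp [coframe_endOfForm, cf2_apply, vertex2, coframe_basis] <;> ring

/-- Besides the cosine only `sin² θ = 3 / 4` is used, so both angles `± 2π/3` are covered. -/
theorem eps_mem {θ : ℝ} (hθ : Real.cos θ = -1 / 2) : eps e θ ∈ Z234 e ∧ eps e θ ∈ Z134 e := by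
  have h := isCompatible_endOfForm ((mem_spaceZ_iff e _).1 (eps_mem_spaceZ e θ))
  have hs : Real.sin θ ^ 2 = 3 / 4 := by
    rw [Real.sin_sq, hθ]; norm_num
  rw [← fundamentalForm_endOfForm e (eps e θ)]
  refine mem_of_nijenhuis_eq_zero h (nijenhuis_eq_zero he 1 ?_ ?_ (fun X Y => ?_) fun X Y => ?_)
  · intros; simp [coframe_endOfForm, cf2_apply, eps, coframe_basis]
  · intros; simp [coframe_endOfForm, cf2_apply, eps, coframe_basis]
  · simp [coframe_endOfForm, cf2_apply, eps, coframe_basis, hθ]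
    linear_combination -(coframe e 0 X * coframe e 3 Y - coframe e 3 X * coframe e 0 Y
      + coframe e 1 X * coframe e 2 Y - coframe e 2 X * coframe e 1 Y) * hs
  · simp [coframe_endOfForm, cf2_apply, eps, coframe_basis, hθ]
    linear_combination -(coframe e 2 X * coframe e 3 Y - coframe e 3 X * coframe e 2 Y) * hs

/-- For `s = 1` the form is closed, so `∇ω` lies in `𝒲₂`, a summand of both classes. -/
theorem circleForm_mem {A B : ℝ} (h : A ^ 2 + B ^ 2 = 1) :
    circleForm e 1 A B ∈ Z234 e ∧ circleForm e 1 A B ∈ Z124 e := by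
  have hJ := isCompatible_endOfForm
    ((mem_spaceZ_iff e _).1 (circleForm_mem_spaceZ e (one_pow 2) h))
  have hm := covDeriv_mem_ghW2 hJ fun X Y Z => by
    simp [metric_lie he, coframe_endOfForm, circleForm_apply, cf2_apply, coframe_basis]
    ring
  rw [fundamentalForm_endOfForm] at hm
  have hω := (fundamentalForm_endOfForm e (circleForm e 1 A B)).symm
  exact ⟨⟨_, hJ, hω, Submodule.mem_sup_left (Submodule.mem_sup_left hm)⟩,
    ⟨_, hJ, hω, Submodule.mem_sup_left (Submodule.mem_sup_right hm)⟩⟩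

/-- For either sign there is no `e^{12}` term, and the coefficients of `e^{14}` and `e^{23}` are
opposite. -/
theorem circleForm_mem_Z123 {s A B : ℝ} (hs : s ^ 2 = 1) (h : A ^ 2 + B ^ 2 = 1) :
    circleForm e s A B ∈ Z123 e := by
  refine mem_Z123 he (circleForm_mem_spaceZ e hs h) ?_ ?_ <;>
    simp [circleForm_apply, cf2_apply, coframe_basis]

theorem eps_mem_Z123 {θ : ℝ} (h : Real.sin θ = 0) : eps e θ ∈ Z123 e := by
  refine mem_Z123 he (eps_mem_spaceZ e θ) ?_ ?_ <;> simp [eps, cf2_apply, coframe_basis, h]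

end Points

/-! ### Edges -/

section Edges

variable {L : Type*} [LieRing L] [LieAlgebra ℝ L]

/-- The entries of the points of an edge `𝓔(e^{pq})`. -/
theorem edge_entries {e : Basis (Fin 6) ℝ L} {p q : Fin 6} (hpq : p ≠ q)
    {ω : LinearMap.BilinForm ℝ L} (hω : ω ∈ edge e (coframe e p) (coframe e q)) :
    ω (e p) (e q) = 1 ∧ ∀ i, i ≠ p → i ≠ q → ω (e p) (e i) = 0 ∧ ω (e q) (e i) = 0 := by
  obtain ⟨-, τ, hτ, rfl⟩ := hω
  -- On a generator `γ ∧ δ` this holds because `γ` and `δ` vanish on `e p` and `e q`.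
  have h : ∀ i, τ (e p) (e i) = 0 ∧ τ (e q) (e i) = 0 := fun i => by
    induction hτ using Submodule.span_induction with
    | mem ρ h =>
      obtain ⟨γ, δ, ⟨h1, h2⟩, ⟨h3, h4⟩, rfl⟩ := h
      simp [inner1, coframe_basis] at h1 h2 h3 h4
      simp [wedge_apply, h1, h2, h3, h4]
    | zero => simp
    | add _ _ _ _ h h' => simp [h, h']
    | smul c _ _ h => simp [h]
  refine ⟨?_, fun i hp hq => ⟨?_, ?_⟩⟩ <;>
    simp [wedge_apply, coframe_basis, *, hpq.symm]

theorem inner2_apply (e : Basis (Fin 6) ℝ L) (σ τ : LinearMap.BilinForm ℝ L) :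
    inner2 e σ τ = σ (e 0) (e 1) * τ (e 0) (e 1) + σ (e 0) (e 2) * τ (e 0) (e 2)
      + σ (e 0) (e 3) * τ (e 0) (e 3) + σ (e 0) (e 4) * τ (e 0) (e 4)
      + σ (e 0) (e 5) * τ (e 0) (e 5) + σ (e 1) (e 2) * τ (e 1) (e 2)
      + σ (e 1) (e 3) * τ (e 1) (e 3) + σ (e 1) (e 4) * τ (e 1) (e 4)
      + σ (e 1) (e 5) * τ (e 1) (e 5) + σ (e 2) (e 3) * τ (e 2) (e 3)
      + σ (e 2) (e 4) * τ (e 2) (e 4) + σ (e 2) (e 5) * τ (e 2) (e 5)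
      + σ (e 3) (e 4) * τ (e 3) (e 4) + σ (e 3) (e 5) * τ (e 3) (e 5)
      + σ (e 4) (e 5) * τ (e 4) (e 5) := by
  have h0 : Finset.Ioi (0 : Fin 6) = {1, 2, 3, 4, 5} := by decide
  have h1 : Finset.Ioi (1 : Fin 6) = {2, 3, 4, 5} := by decide
  have h2 : Finset.Ioi (2 : Fin 6) = {3, 4, 5} := by decide
  have h3 : Finset.Ioi (3 : Fin 6) = {4, 5} := by decide
  have h4 : Finset.Ioi (4 : Fin 6) = {5} := by decide
  have h5 : Finset.Ioi (5 : Fin 6) = ∅ := by decide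
  simp [inner2, Fin.sum_univ_six, h0, h1, h2, h3, h4, h5]
  ring

variable {e : Basis (Fin 6) ℝ L} {ω : LinearMap.BilinForm ℝ L}

theorem equator02_entries (hω : ω ∈ equator02 e) : ω (e 2) (e 3) = 1 ∧ ω (e 0) (e 1) = 0
    ∧ ω (e 0) (e 3) = 0 ∧ ω (e 1) (e 2) = 0 := by
  obtain ⟨hω, hi⟩ := hω
  have hm := (mem_spaceZ_iff e ω).1 hω.1
  obtain ⟨h1, h⟩ := edge_entries (by decide) hω
  have h0 := h 0 (by decide) (by decide)
  have h1' := h 1 (by decide) (by decide)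
  have h4 := h 4 (by decide) (by decide)
  have h5 := h 5 (by decide) (by decide)
  have hd := hm.duality.1
  have s1 := hm.skew 0 3
  have s2 := hm.skew 1 2
  simp only [h1, h4, h5, h0, h1'] at hd s1 s2
  simp [inner2_apply, vertex0, vertex2, cf2_apply, coframe_basis] at hi
  -- Duality gives `ω(e₁, e₂) = ω(e₅, e₆)`, while the equator condition makes them opposite.
  refine ⟨h1, ?_, ?_, ?_⟩ <;> linarith

theorem equator13_entries (hω : ω ∈ equator13 e) : ω (e 2) (e 3) = -1 ∧ ω (e 0) (e 1) = 0
    ∧ ω (e 0) (e 3) = 0 ∧ ω (e 1) (e 2) = 0 := by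
  obtain ⟨hω, hi⟩ := hω
  have hm := (mem_spaceZ_iff e ω).1 hω.1
  obtain ⟨h1, h⟩ := edge_entries (by decide) hω
  have h0 := h 0 (by decide) (by decide)
  have h1' := h 1 (by decide) (by decide)
  have h4 := h 4 (by decide) (by decide)
  have h5 := h 5 (by decide) (by decide)
  have hd := hm.duality.1
  have s1 := hm.skew 0 3
  have s2 := hm.skew 1 2
  have s3 := hm.skew 2 3
  simp only [h1, h4, h5, h0, h1'] at hd s1 s2 s3
  rw [s3] at hd
  simp [inner2_apply, vertex1, vertex3, cf2_apply, coframe_basis] at hi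
  -- The signs are exchanged: duality makes `ω(e₁, e₂)` and `ω(e₅, e₆)` opposite, the equator
  -- condition equal.
  refine ⟨s3, ?_, ?_, ?_⟩ <;> linarith

theorem equator12_entries (hω : ω ∈ equator12 e) : ω (e 4) (e 5) = -1 ∧ ω (e 2) (e 3) = 0
    ∧ ω (e 0) (e 1) = 0 ∧ ω (e 0) (e 3) + ω (e 1) (e 2) = 0 := by
  obtain ⟨hω, hi⟩ := hω
  have hm := (mem_spaceZ_iff e ω).1 hω.1
  obtain ⟨h1, h⟩ := edge_entries (by decide) hω
  have s : ω (e 4) (e 5) = -1 := by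
    have := hm.skew 4 5
    simp only [h1] at this
    exact this
  have s' : ∀ i, i ≠ 5 → i ≠ 4 → ω (e i) (e 4) = 0 ∧ ω (e i) (e 5) = 0 := fun i h5 h4 => by
    have h6 := hm.skew i 4
    have h7 := hm.skew i 5
    simp only [h i h5 h4] at h6 h7
    exact ⟨by linarith, by linarith⟩
  have h0 := s' 0 (by decide) (by decide)
  have h1' := s' 1 (by decide) (by decide)
  have h2 := s' 2 (by decide) (by decide)
  have h3 := s' 3 (by decide) (by decide)
  obtain ⟨d1, -, d3, -⟩ := hm.duality
  simp only [s, h1', h2, h3] at d1 d3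
  simp [inner2_apply, vertex1, vertex2, cf2_apply, coframe_basis] at hi
  -- Duality makes the block on `e₁, …, e₄` anti-self-dual, so `ω(e₁, e₂) = -ω(e₃, e₄)`; the equator
  -- condition makes these two equal.
  refine ⟨s, ?_, ?_, ?_⟩ <;> linarith

end Edges

/-! ### Algebra of the equations for the entries of `J` -/

section Algebra

set_option linter.unusedSimpArgs false

/-- Let `T` be the upper left `4 × 4` block, `A` and `B` the first four entries of the rows `a 4`
and `a 5`, and `c = a 4 5`. Then `a² = -1` gives `T A = c B` and `|A|² = 1 - c²`. -/
theorem IsComplexMatrix.row_four {a : Fin 6 → Fin 6 → ℝ} (ha : IsComplexMatrix a) :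
    -a 4 1 * a 0 1 - a 4 2 * a 0 2 - a 4 3 * a 0 3 = -a 4 5 * a 5 0 ∧
    a 4 0 * a 0 1 - a 4 2 * a 1 2 - a 4 3 * a 1 3 = -a 4 5 * a 5 1 ∧
    a 4 0 * a 0 2 + a 4 1 * a 1 2 - a 4 3 * a 2 3 = -a 4 5 * a 5 2 ∧
    a 4 0 * a 0 3 + a 4 1 * a 1 3 + a 4 2 * a 2 3 = -a 4 5 * a 5 3 ∧
    a 4 0 ^ 2 + a 4 1 ^ 2 + a 4 2 ^ 2 + a 4 3 ^ 2 = 1 - a 4 5 ^ 2 := by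
  have h := ha.sq 4
  have s := ha.skew
  simp only [Fin.sum_univ_six] at h
  refine ⟨?_, ?_, ?_, ?_, ?_⟩
  · have h := h 0
    simp [ha.diag, s 1 0, s 2 0, s 3 0, s 2 1, s 3 1, s 3 2] at h
    linear_combination h
  · have h := h 1
    simp [ha.diag, s 1 0, s 2 0, s 3 0, s 2 1, s 3 1, s 3 2] at h
    linear_combination h
  · have h := h 2
    simp [ha.diag, s 1 0, s 2 0, s 3 0, s 2 1, s 3 1, s 3 2] at h
    linear_combination h
  · have h := h 3
    simp [ha.diag, s 1 0, s 2 0, s 3 0, s 2 1, s 3 1, s 3 2] at h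
    linear_combination h
  · have h := h 4
    simp [ha.diag, s 0 4, s 1 4, s 2 4, s 3 4, s 5 4] at h
    linear_combination -h

/-- In the same notation, `T B = -c A` and `|B|² = 1 - c²`. -/
theorem IsComplexMatrix.row_five {a : Fin 6 → Fin 6 → ℝ} (ha : IsComplexMatrix a) :
    -a 5 1 * a 0 1 - a 5 2 * a 0 2 - a 5 3 * a 0 3 = a 4 5 * a 4 0 ∧
    a 5 0 * a 0 1 - a 5 2 * a 1 2 - a 5 3 * a 1 3 = a 4 5 * a 4 1 ∧
    a 5 0 * a 0 2 + a 5 1 * a 1 2 - a 5 3 * a 2 3 = a 4 5 * a 4 2 ∧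
    a 5 0 * a 0 3 + a 5 1 * a 1 3 + a 5 2 * a 2 3 = a 4 5 * a 4 3 ∧
    a 5 0 ^ 2 + a 5 1 ^ 2 + a 5 2 ^ 2 + a 5 3 ^ 2 = 1 - a 4 5 ^ 2 := by
  have h := ha.sq 5
  have s := ha.skew
  simp only [Fin.sum_univ_six] at h
  refine ⟨?_, ?_, ?_, ?_, ?_⟩
  · have h := h 0
    simp [ha.diag, s 1 0, s 2 0, s 3 0, s 2 1, s 3 1, s 3 2, s 5 4] at h
    linear_combination h
  · have h := h 1
    simp [ha.diag, s 1 0, s 2 0, s 3 0, s 2 1, s 3 1, s 3 2, s 5 4] at h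
    linear_combination h
  · have h := h 2
    simp [ha.diag, s 1 0, s 2 0, s 3 0, s 2 1, s 3 1, s 3 2, s 5 4] at h
    linear_combination h
  · have h := h 3
    simp [ha.diag, s 1 0, s 2 0, s 3 0, s 2 1, s 3 1, s 3 2, s 5 4] at h
    linear_combination h
  · have h := h 5
    simp [ha.diag, s 0 5, s 1 5, s 2 5, s 3 5, s 5 4] at h
    linear_combination -h

/-- In the same notation, `T² = -1 + A ⊗ A + B ⊗ B`. -/
theorem IsComplexMatrix.block_sq {a : Fin 6 → Fin 6 → ℝ} (ha : IsComplexMatrix a) :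
    -a 0 1 * a 0 1 - a 0 2 * a 0 2 - a 0 3 * a 0 3 = -1 + a 4 0 * a 4 0 + a 5 0 * a 5 0 ∧
    -a 0 2 * a 1 2 - a 0 3 * a 1 3 = a 4 0 * a 4 1 + a 5 0 * a 5 1 ∧
    a 0 1 * a 1 2 - a 0 3 * a 2 3 = a 4 0 * a 4 2 + a 5 0 * a 5 2 ∧
    a 0 1 * a 1 3 + a 0 2 * a 2 3 = a 4 0 * a 4 3 + a 5 0 * a 5 3 ∧
    -a 0 1 * a 0 1 - a 1 2 * a 1 2 - a 1 3 * a 1 3 = -1 + a 4 1 * a 4 1 + a 5 1 * a 5 1 ∧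
    -a 0 1 * a 0 2 - a 1 3 * a 2 3 = a 4 1 * a 4 2 + a 5 1 * a 5 2 ∧
    -a 0 1 * a 0 3 + a 1 2 * a 2 3 = a 4 1 * a 4 3 + a 5 1 * a 5 3 ∧
    -a 0 2 * a 0 2 - a 1 2 * a 1 2 - a 2 3 * a 2 3 = -1 + a 4 2 * a 4 2 + a 5 2 * a 5 2 ∧
    -a 0 2 * a 0 3 - a 1 2 * a 1 3 = a 4 2 * a 4 3 + a 5 2 * a 5 3 ∧
    -a 0 3 * a 0 3 - a 1 3 * a 1 3 - a 2 3 * a 2 3 = -1 + a 4 3 * a 4 3 + a 5 3 * a 5 3 := by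
  have h := ha.sq
  have s := ha.skew
  simp only [Fin.sum_univ_six] at h
  refine ⟨?_, ?_, ?_, ?_, ?_, ?_, ?_, ?_, ?_, ?_⟩
  · have h := h 0 0
    simp [ha.diag, s 1 0, s 2 0, s 3 0, s 2 1, s 3 1, s 3 2, s 0 4, s 1 4, s 2 4, s 3 4, s 0 5,
      s 1 5,
      s 2 5, s 3 5] at h
    linear_combination h
  · have h := h 0 1
    simp [ha.diag, s 1 0, s 2 0, s 3 0, s 2 1, s 3 1, s 3 2, s 0 4, s 1 4, s 2 4, s 3 4, s 0 5,
      s 1 5,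
      s 2 5, s 3 5] at h
    linear_combination h
  · have h := h 0 2
    simp [ha.diag, s 1 0, s 2 0, s 3 0, s 2 1, s 3 1, s 3 2, s 0 4, s 1 4, s 2 4, s 3 4, s 0 5,
      s 1 5,
      s 2 5, s 3 5] at h
    linear_combination h
  · have h := h 0 3
    simp [ha.diag, s 1 0, s 2 0, s 3 0, s 2 1, s 3 1, s 3 2, s 0 4, s 1 4, s 2 4, s 3 4, s 0 5,
      s 1 5,
      s 2 5, s 3 5] at h
    linear_combination h
  · have h := h 1 1
    simp [ha.diag, s 1 0, s 2 0, s 3 0, s 2 1, s 3 1, s 3 2, s 0 4, s 1 4, s 2 4, s 3 4, s 0 5,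
      s 1 5,
      s 2 5, s 3 5] at h
    linear_combination h
  · have h := h 1 2
    simp [ha.diag, s 1 0, s 2 0, s 3 0, s 2 1, s 3 1, s 3 2, s 0 4, s 1 4, s 2 4, s 3 4, s 0 5,
      s 1 5,
      s 2 5, s 3 5] at h
    linear_combination h
  · have h := h 1 3
    simp [ha.diag, s 1 0, s 2 0, s 3 0, s 2 1, s 3 1, s 3 2, s 0 4, s 1 4, s 2 4, s 3 4, s 0 5,
      s 1 5,
      s 2 5, s 3 5] at h
    linear_combination h
  · have h := h 2 2
    simp [ha.diag, s 1 0, s 2 0, s 3 0, s 2 1, s 3 1, s 3 2, s 0 4, s 1 4, s 2 4, s 3 4, s 0 5,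
      s 1 5,
      s 2 5, s 3 5] at h
    linear_combination h
  · have h := h 2 3
    simp [ha.diag, s 1 0, s 2 0, s 3 0, s 2 1, s 3 1, s 3 2, s 0 4, s 1 4, s 2 4, s 3 4, s 0 5,
      s 1 5,
      s 2 5, s 3 5] at h
    linear_combination h
  · have h := h 3 3
    simp [ha.diag, s 1 0, s 2 0, s 3 0, s 2 1, s 3 1, s 3 2, s 0 4, s 1 4, s 2 4, s 3 4, s 0 5,
      s 1 5,
      s 2 5, s 3 5] at h
    linear_combination h

/-- The structure equations force an integrable structure to preserve the plane of `e₅, e₆`: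
the hypotheses are the vanishing of components of the totally skew Nijenhuis tensor. -/
theorem IsComplexMatrix.sq_eq_one_of_integrable {a : Fin 6 → Fin 6 → ℝ} (ha : IsComplexMatrix a)
    (hi0 : -a 4 1 = a 4 5 * (a 4 0 * a 0 3 + a 4 1 * a 0 2 - a 4 2 * a 0 1))
    (hi1 : a 4 0 = a 4 5 * (a 4 0 * a 1 3 + a 4 3 * a 0 1 + a 4 1 * a 1 2))
    (hi2 : 0 = a 4 5 * (a 4 0 * a 2 3 + a 4 3 * a 0 2 + a 4 2 * a 1 2))
    (hi3 : 0 = a 4 5 * (a 4 3 * a 0 3 - a 4 1 * a 2 3 + a 4 2 * a 1 3))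
    (hj0 : -a 5 3 = -a 4 5 * a 5 0 * a 0 1)
    (hj1 : -a 5 2 = -a 4 5 * a 5 1 * a 0 1)
    (hj2 : a 5 1 = -a 4 5 * (-a 5 0 * a 1 2 + a 5 1 * a 0 2))
    (hj3 : a 5 0 = -a 4 5 * (-a 5 0 * a 1 3 + a 5 1 * a 0 3))
    (hk0 : -a 4 3 + a 4 5 * a 4 0 * a 0 1
      = -((a 4 0 * a 5 1 - a 4 1 * a 5 0) * a 4 0
        + (a 4 0 * a 5 3 - a 4 3 * a 5 0 + a 4 1 * a 5 2 - a 4 2 * a 5 1) * a 5 0))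
    (hk1 : -a 4 2 + a 4 5 * a 4 1 * a 0 1
      = -((a 4 0 * a 5 1 - a 4 1 * a 5 0) * a 4 1
        + (a 4 0 * a 5 3 - a 4 3 * a 5 0 + a 4 1 * a 5 2 - a 4 2 * a 5 1) * a 5 1))
    (hk2 : a 4 1 + a 4 5 * (-a 4 0 * a 1 2 + a 4 1 * a 0 2)
      = -((a 4 0 * a 5 1 - a 4 1 * a 5 0) * a 4 2
        + (a 4 0 * a 5 3 - a 4 3 * a 5 0 + a 4 1 * a 5 2 - a 4 2 * a 5 1) * a 5 2))
    (hk3 : a 4 0 + a 4 5 * (-a 4 0 * a 1 3 + a 4 1 * a 0 3)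
      = -((a 4 0 * a 5 1 - a 4 1 * a 5 0) * a 4 3
        + (a 4 0 * a 5 3 - a 4 3 * a 5 0 + a 4 1 * a 5 2 - a 4 2 * a 5 1) * a 5 3))
    : a 4 5 ^ 2 = 1 := by
  obtain ⟨hA0, hA1, hA2, hA3, hA⟩ := ha.row_four
  obtain ⟨hB0, hB1, hB2, hB3, hB⟩ := ha.row_five
  obtain ⟨t00, t01, t02, t03, t11, t12, t13, t22, t23, t33⟩ := ha.block_sq
  -- Let `i = (-A₁, A₀, 0, 0)` and `h = (-A₃, -A₂, A₁, A₀)` be the contractions of `e^{12}` and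
  -- `e^{14} + e^{23}` with `A`. The hypotheses `hi0`–`hi3` say `i = c T h`. Pairing with `B` gives
  -- `i · B = 0`, as `T` is skew, `T B = -c A` and `h ⟂ A`. In the same way `hb`, which is `h · B =
  -- 0`, follows from `hj0`–`hj3`.
  have hf : a 4 0 * a 5 1 - a 4 1 * a 5 0 = 0 := by
    linear_combination a 5 0 * hi0 + a 5 1 * hi1 + a 5 2 * hi2 + a 5 3 * hi3 + a 4 5 * (-a 4 3) * hB0
      + a 4 5 * (-a 4 2) * hB1 + a 4 5 * a 4 1 * hB2 + a 4 5 * a 4 0 * hB3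
  have hb : a 4 0 * a 5 3 - a 4 3 * a 5 0 + a 4 1 * a 5 2 - a 4 2 * a 5 1 = 0 := by
    linear_combination -a 4 0 * hj0 - a 4 1 * hj1 - a 4 2 * hj2 - a 4 3 * hj3 + a 4 5 * (-a 5 1) * hA0
      + a 4 5 * a 5 0 * hA1
  -- With `hf` and `hb` the last four hypotheses become `h = -c T i`.
  have hk0 : -a 4 3 + a 4 5 * a 4 0 * a 0 1 = 0 := by
    linear_combination hk0 - a 4 0 * hf - a 5 0 * hb
  have hk1 : -a 4 2 + a 4 5 * a 4 1 * a 0 1 = 0 := by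
    linear_combination hk1 - a 4 1 * hf - a 5 1 * hb
  have hk2 : a 4 1 + a 4 5 * (-a 4 0 * a 1 2 + a 4 1 * a 0 2) = 0 := by
    linear_combination hk2 - a 4 2 * hf - a 5 2 * hb
  have hk3 : a 4 0 + a 4 5 * (-a 4 0 * a 1 3 + a 4 1 * a 0 3) = 0 := by
    linear_combination hk3 - a 4 3 * hf - a 5 3 * hb
  -- Now `i = c T h = -c² T² i = c² i`: the corrections in `T²` vanish since `i` is orthogonal to
  -- `A` and `B`. The same argument applies to `h`.
  have hg0 : (1 - a 4 5 ^ 2) * (-a 4 1) = 0 := by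
    linear_combination hi0 + a 4 5 * a 0 1 * hk1 + a 4 5 * a 0 2 * hk2 + a 4 5 * a 0 3 * hk3
      - a 4 5 ^ 2 * (-a 4 1) * t00 - a 4 5 ^ 2 * a 4 0 * t01 - a 4 5 ^ 2 * a 5 0 * hf
  have hg1 : (1 - a 4 5 ^ 2) * a 4 0 = 0 := by
    linear_combination hi1 + a 4 5 * (-a 0 1) * hk0 + a 4 5 * a 1 2 * hk2 + a 4 5 * a 1 3 * hk3
      - a 4 5 ^ 2 * (-a 4 1) * t01 - a 4 5 ^ 2 * a 4 0 * t11 - a 4 5 ^ 2 * a 5 1 * hf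
  have hh0 : (1 - a 4 5 ^ 2) * (-a 4 3) = 0 := by
    linear_combination hk0 - a 4 5 * a 0 1 * hi1 - a 4 5 * a 0 2 * hi2 - a 4 5 * a 0 3 * hi3
      - a 4 5 ^ 2 * (-a 4 3) * t00 - a 4 5 ^ 2 * (-a 4 2) * t01 - a 4 5 ^ 2 * a 4 1 * t02
      - a 4 5 ^ 2 * a 4 0 * t03 - a 4 5 ^ 2 * a 5 0 * hb
  have hh1 : (1 - a 4 5 ^ 2) * (-a 4 2) = 0 := by
    linear_combination hk1 - a 4 5 * (-a 0 1) * hi0 - a 4 5 * a 1 2 * hi2 - a 4 5 * a 1 3 * hi3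
      - a 4 5 ^ 2 * (-a 4 3) * t01 - a 4 5 ^ 2 * (-a 4 2) * t11 - a 4 5 ^ 2 * a 4 1 * t12
      - a 4 5 ^ 2 * a 4 0 * t13 - a 4 5 ^ 2 * a 5 1 * hb
  -- The entries of `h` are those of `A` up to order and sign, and `|A|² = 1 - c²`.
  have h : (1 - a 4 5 ^ 2) ^ 2 = 0 := by
    linear_combination -(1 - a 4 5 ^ 2) * hA + a 4 0 * hg1 - a 4 1 * hg0 - a 4 3 * hh0 - a 4 2 * hh1
  linarith [pow_eq_zero_iff two_ne_zero |>.1 h]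

theorem IsComplexMatrix.rows_eq_zero_of_sq_eq_one {a : Fin 6 → Fin 6 → ℝ}
    (ha : IsComplexMatrix a) (hc : a 4 5 ^ 2 = 1) :
    (a 4 0 = 0 ∧ a 4 1 = 0 ∧ a 4 2 = 0 ∧ a 4 3 = 0) ∧
      a 5 0 = 0 ∧ a 5 1 = 0 ∧ a 5 2 = 0 ∧ a 5 3 = 0 := by
  obtain ⟨-, -, -, -, hA⟩ := ha.row_four
  obtain ⟨-, -, -, -, hB⟩ := ha.row_five
  rw [hc, sub_self] at hA hB
  have h : ∀ x y z w : ℝ, x ^ 2 + y ^ 2 + z ^ 2 + w ^ 2 = 0 → x = 0 ∧ y = 0 ∧ z = 0 ∧ w = 0 :=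
    fun x y z w h => by
      refine ⟨?_, ?_, ?_, ?_⟩ <;> refine pow_eq_zero_iff two_ne_zero |>.1 ?_ <;>
        nlinarith [sq_nonneg x, sq_nonneg y, sq_nonneg z, sq_nonneg w]
  exact ⟨h _ _ _ _ hA, h _ _ _ _ hB⟩

/-- The equations for a vanishing component in `𝒲₃` force `J e₅ ⟂ e₆` or `J e₅ = ± e₆`. -/
theorem IsComplexMatrix.sq_eq_one_of_ne_zero {a : Fin 6 → Fin 6 → ℝ} (ha : IsComplexMatrix a) {l m : ℝ}
    (hc : a 4 5 ≠ 0)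
    (hv0 : 2 * a 4 5 * a 4 3 = m * a 5 0) (hv1 : 2 * a 4 5 * a 4 2 = m * a 5 1)
    (hv2 : -2 * a 4 5 * a 4 1 = m * a 5 2) (hv3 : -2 * a 4 5 * a 4 0 = m * a 5 3)
    (hw0 : 2 * a 4 5 * a 5 1 = -l * a 4 0) (hw1 : 2 * a 4 5 * a 5 0 = l * a 4 1)
    (hw2 : l * a 4 2 = 0) (hw3 : l * a 4 3 = 0)
    (hx0 : 2 * a 4 5 * (a 4 1 - a 5 3) = m * a 4 0 + l * a 5 0)
    (hx1 : -2 * a 4 5 * (a 4 0 + a 5 2) = m * a 4 1 + l * a 5 1) : a 4 5 ^ 2 = 1 := by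
  obtain ⟨-, -, -, -, hA⟩ := ha.row_four
  obtain ⟨-, -, -, -, hB⟩ := ha.row_five
  by_contra hne
  have hne' : 1 - a 4 5 ^ 2 ≠ 0 := fun h => hne (by linarith)
  -- The equations `hv0`–`hv3` equate `m B` with `2c` times a signed rearrangement of `A`, and `|A|²
  -- = |B|² ≠ 0`.
  have hm : m ^ 2 = (2 * a 4 5) ^ 2 := by
    refine mul_right_cancel₀ hne' ?_
    linear_combination -m ^ 2 * hB + (2 * a 4 5) ^ 2 * hA
      - (m * a 5 0 + 2 * a 4 5 * a 4 3) * hv0 - (m * a 5 1 + 2 * a 4 5 * a 4 2) * hv1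
      - (m * a 5 2 - 2 * a 4 5 * a 4 1) * hv2 - (m * a 5 3 - 2 * a 4 5 * a 4 0) * hv3
  have h2c : 2 * a 4 5 ≠ 0 := mul_ne_zero two_ne_zero hc
  have hm0 : m ≠ 0 := fun h => by
    rw [h] at hm
    exact h2c (pow_eq_zero_iff two_ne_zero |>.1 (by linarith))
  have zero : ∀ x y : ℝ, x ≠ 0 → x * y = 0 → y = 0 := fun x y hx h =>
    (mul_eq_zero.1 h).resolve_left hx
  -- This contradicts `|A|² = 1 - c² ≠ 0`.
  have hall : a 4 0 = 0 ∧ a 4 1 = 0 ∧ a 4 2 = 0 ∧ a 4 3 = 0 := by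
    by_cases hl : l = 0
    · rw [hl] at hw0 hw1
      have b1 := zero _ (a 5 1) h2c (by linarith)
      have b0 := zero _ (a 5 0) h2c (by linarith)
      rw [b0] at hv0 hx0
      rw [b1] at hv1 hx1
      refine ⟨?_, ?_, zero _ _ h2c (by linarith), zero _ _ h2c (by linarith)⟩
      · refine zero _ _ (pow_ne_zero 2 h2c) ?_
        have h : 2 * a 4 5 * (m * (a 4 0 + a 5 2)) + m ^ 2 * a 4 1 = 0 := by
          linear_combination -m * hx1
        have h' : 2 * a 4 5 * (m * (a 4 0 + a 5 2)) + (2 * a 4 5) ^ 2 * a 4 1 = 0 := by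
          rw [← hm]; exact h
        have h3 : m * a 4 0 = 0 := zero _ _ h2c (by linear_combination h' - (2 * a 4 5) * (-hv2))
        have := zero _ _ hm0 h3
        rw [this, mul_zero]
      · have h : 2 * a 4 5 * (m * (a 4 1 - a 5 3)) - (2 * a 4 5) ^ 2 * a 4 0 = 0 := by
          rw [← hm]; linear_combination m * hx0
        have h3 : m * a 4 1 = 0 := zero _ _ h2c (by linear_combination h - (2 * a 4 5) * hv3)
        exact zero _ _ hm0 h3
    · have h2 := zero _ _ hl hw2
      have h3 := zero _ _ hl hw3
      rw [h2] at hv1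
      rw [h3] at hv0
      have b0 := zero _ (a 5 0) hm0 (by linarith)
      have b1 := zero _ (a 5 1) hm0 (by linarith)
      rw [b1] at hw0
      rw [b0] at hw1
      exact ⟨zero _ _ hl (by linarith), zero _ _ hl (by linarith), h2, h3⟩
  obtain ⟨h0, h1, h2, h3⟩ := hall
  rw [h0, h1, h2, h3] at hA
  exact hne' (by linarith)

/-- The solutions with `J e₅ ⟂ e₆` of the equations for `𝒲₁ ⊕ 𝒲₂ ⊕ 𝒲₄`. -/
theorem IsComplexMatrix.rows_of_orthogonal {a : Fin 6 → Fin 6 → ℝ} (ha : IsComplexMatrix a)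
    {t : ℝ} (hc : a 4 5 = 0) (h0 : a 5 1 - a 4 3 = t * a 4 0) (h1 : -a 5 0 - a 4 2 = t * a 4 1)
    (h2 : a 4 1 = t * a 4 2) (h3 : a 4 0 = t * a 4 3) :
    a 4 0 = 0 ∧ a 4 1 = 0 ∧ a 5 0 = -a 4 2 ∧ a 5 1 = a 4 3 ∧ a 5 2 = 0 ∧ a 5 3 = 0 ∧
      a 4 2 ^ 2 + a 4 3 ^ 2 = 1 := by
  obtain ⟨-, -, -, -, hA⟩ := ha.row_four
  obtain ⟨-, -, -, -, hB⟩ := ha.row_five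
  rw [hc] at hA hB
  have b1 : a 5 1 = (1 + t ^ 2) * a 4 3 := by linear_combination h0 + t * h3
  have b0 : a 5 0 = -(1 + t ^ 2) * a 4 2 := by linear_combination -h1 - t * h2
  have hn : (1 + t ^ 2) * (a 4 2 ^ 2 + a 4 3 ^ 2) = 1 := by
    rw [h2, h3] at hA
    linear_combination hA
  -- Since `|B| = 1`, this sum is at most `1`, which forces `t = 0` and the vanishing of the other
  -- two entries of `B`.
  have hb : a 5 0 ^ 2 + a 5 1 ^ 2 = 1 + t ^ 2 := by
    rw [b0, b1]; linear_combination (1 + t ^ 2) * hn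
  have ht : t = 0 := pow_eq_zero_iff two_ne_zero |>.1 (le_antisymm
    (by nlinarith [sq_nonneg (a 5 2), sq_nonneg (a 5 3)]) (sq_nonneg t))
  subst ht
  have b2 : a 5 2 = 0 := pow_eq_zero_iff two_ne_zero |>.1 (le_antisymm
    (by nlinarith [sq_nonneg (a 5 3)]) (sq_nonneg _))
  have b3 : a 5 3 = 0 := pow_eq_zero_iff two_ne_zero |>.1 (le_antisymm
    (by nlinarith [sq_nonneg (a 5 2)]) (sq_nonneg _))
  exact ⟨by linarith, by linarith, by linarith, by linarith, b2, b3, by linarith⟩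

end Algebra

/-! ### Determination of `𝒵₁₃₄` and `𝒵₁₂₄`, and distinctness -/

section Classification

set_option linter.unusedSimpArgs false

variable {L : Type*} [LieRing L] [LieAlgebra ℝ L]

theorem metric_basis_left (e : Basis (Fin 6) ℝ L) (k : Fin 6) (X : L) :
    metric e (e k) X = coframe e k X := by
  rw [metric_comm, metric_basis]

theorem nijenhuis_swap_left {e : Basis (Fin 6) ℝ L} {J : Module.End ℝ L} (X Y Z : L) :
    nijenhuis e J X Y Z = -nijenhuis e J Y X Z := by
  unfold nijenhuis
  linarith [metric_lie_skew e (J X) Y Z, metric_lie_skew e X (J Y) Z,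
    metric_lie_skew e X Y (J Z), metric_lie_skew e (J X) (J Y) (J Z)]

/-- Without a component in `𝒲₂` the Nijenhuis tensor is totally skew. -/
theorem nijenhuis_swap_right {e : Basis (Fin 6) ℝ L} {J : Module.End ℝ L}
    (hJ : IsCompatible e J)
    (h : ∀ X Z, covDeriv e (fundamentalForm e J) (J X) (J X) Z
      = covDeriv e (fundamentalForm e J) X X Z) (X Y Z : L) :
    nijenhuis e J X Y Z = -nijenhuis e J X Z Y := by
  -- At `(X, X, Z)` the right side of `covDeriv_sub_twist` reduces to `2 N(Z, X, X)`; polarization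
  -- then gives skewness.
  have h0 : ∀ X Z, nijenhuis e J Z X X = 0 := fun X Z => by
    have h1 := covDeriv_sub_twist hJ X X Z
    rw [h, sub_self, mul_zero] at h1
    linarith [nijenhuis_swap_left (e := e) (J := J) X X Z,
      nijenhuis_swap_left (e := e) (J := J) X Z X]
  have h1 := h0 (Y + Z) X
  have h2 := h0 Y X
  have h3 := h0 Z X
  unfold nijenhuis at *
  simp only [lie_add, map_add, LinearMap.add_apply] at h1
  linarith

/-- The equation for `∇ω` to have no component in `𝒲₃`. -/
theorem koszul_eq_of_mem {e : Basis (Fin 6) ℝ L} (he : StructureEquations e)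
    {J : Module.End ℝ L} (hJ : IsCompatible e J)
    (h : covDeriv e (fundamentalForm e J) ∈ ghW1 J ⊔ ghW2 J ⊔ ghW4 e J) {l m : ℝ}
    (hl : l = coframe e 1 (J (e 0))) (hm : m = coframe e 3 (J (e 0)) + coframe e 2 (J (e 1)))
    (X Y Z : L) :
    koszul e X Y (J Z) + koszul e X (J Y) Z + koszul e (J X) (J Y) (J Z) - koszul e (J X) Y Z
      + (metric e X Y * (l * coframe e 4 Z + m * coframe e 5 Z)
        - metric e X Z * (l * coframe e 4 Y + m * coframe e 5 Y)
        - metric e X (J Y) * (l * coframe e 4 (J Z) + m * coframe e 5 (J Z))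
        + metric e X (J Z) * (l * coframe e 4 (J Y) + m * coframe e 5 (J Y))) = 0 := by
  obtain ⟨θ, hθ, h⟩ := twist_add_of_mem hJ h
  have hθ' : ∀ Z, l * coframe e 4 Z + m * coframe e 5 Z = -4 * θ Z := fun Z => by
    have := hθ Z
    rw [covDeriv_trace he hJ, ← hl, ← hm] at this
    linarith
  have h0 := h X Y Z
  have h1 := covDeriv_koszul hJ X Y Z
  have h2 := covDeriv_koszul hJ (J X) (J Y) Z
  rw [hJ.sq, koszul_neg, koszul_swap e (J X) Y Z] at h2
  have h3 := koszul_swap e X (J Y) Z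
  rw [leeTensor_apply] at h0
  simp only [hθ']
  linarith

theorem fundamentalForm_eq {e : Basis (Fin 6) ℝ L} {J : Module.End ℝ L} (hJ : IsCompatible e J)
    {η : LinearMap.BilinForm ℝ L} (hη : η ∈ spaceZ e)
    (h : ∀ i j, i < j → coframe e j (J (e i)) = η (e i) (e j)) : fundamentalForm e J = η :=
  form_ext e ((mem_spaceZ_iff e _).1 ⟨J, hJ, rfl⟩).skew ((mem_spaceZ_iff e _).1 hη).skew
    fun i j hij => by rw [← h i j hij, ← metric_basis]; rfl

theorem eq_one_or_of_sq {x : ℝ} (h : x ^ 2 = 1) : x = 1 ∨ x = -1 :=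
  sq_eq_sq_iff_eq_or_eq_neg.1 (by rw [h, one_pow])

theorem cos_two_pi_div_three : Real.cos (2 * Real.pi / 3) = -1 / 2 := by
  rw [show 2 * Real.pi / 3 = Real.pi - Real.pi / 3 by ring, Real.cos_pi_sub, Real.cos_pi_div_three]
  norm_num

theorem sin_two_pi_div_three : Real.sin (2 * Real.pi / 3) = √3 / 2 := by
  rw [show 2 * Real.pi / 3 = Real.pi - Real.pi / 3 by ring, Real.sin_pi_sub, Real.sin_pi_div_three]

/-- The structures preserving the plane of `e₅, e₆` for which the Nijenhuis tensor vanishes. -/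
theorem IsComplexMatrix.cases_of_integrable {a : Fin 6 → Fin 6 → ℝ} (ha : IsComplexMatrix a)
    (hc : a 4 5 ^ 2 = 1) (h1 : (a 0 3 * a 0 1 + a 0 1 * a 1 2) * a 4 5 = 0)
    (h2 : a 1 2 + (a 0 3 * a 0 2 + a 0 2 * a 1 2) * a 4 5 = 0)
    (h3 : a 1 3 + (a 0 3 ^ 2 - a 0 1 * a 2 3 + a 0 2 * a 1 3 - 1) * a 4 5 = 0) :
    (a 0 2 = 0 ∧ a 1 3 = 0 ∧ a 0 3 = 0 ∧ a 1 2 = 0 ∧ a 2 3 = -a 0 1 ∧ a 4 5 = -1 ∧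
      (a 0 1 = 1 ∨ a 0 1 = -1)) ∨
    (a 0 1 = 0 ∧ a 2 3 = 0 ∧ a 0 2 = -1 / 2 ∧ a 1 3 = 1 / 2 ∧ a 1 2 = a 0 3 ∧ a 4 5 = 1 ∧
      (a 0 3 = √3 / 2 ∨ a 0 3 = -(√3 / 2))) := by
  obtain ⟨⟨z0, z1, z2, z3⟩, w0, w1, w2, w3⟩ := ha.rows_eq_zero_of_sq_eq_one hc
  have s := ha.skew
  obtain ⟨d1, d2, d3, d4, d5, d6⟩ := ha.duality
  have hr := ha.row 0
  simp only [Fin.sum_univ_six, ha.diag, s 0 4, s 1 4, s 2 4, s 3 4, s 0 5, s 1 5, s 2 5, s 3 5, z0,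
    z1, z2, z3, w0, w1, w2, w3] at d1 d2 d3 d4 d5 d6 hr
  have hsqrt : √3 ^ 2 = 3 := Real.sq_sqrt (by norm_num)
  rcases eq_one_or_of_sq hc with hc | hc
  · right
    rw [hc] at d1 d2 d3 h1 h2 h3
    -- For `c = 1` duality says that the block on `e₁, …, e₄` is self-dual; for `c = -1` it is
    -- anti-self-dual.
    have e12 : a 1 2 = a 0 3 := by linarith
    have e13 : a 1 3 = -a 0 2 := by linarith
    have e23 : a 2 3 = a 0 1 := by linarith
    rw [e12] at h1 h2
    rw [e13, e23] at h3
    have h03 : a 0 3 ≠ 0 := fun h => by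
      rw [h] at hr h3
      have : a 0 2 = -2 := by linarith
      rw [this] at hr
      nlinarith [sq_nonneg (a 0 1)]
    have h02 : a 0 2 = -1 / 2 := by
      have : a 0 3 * (1 + 2 * a 0 2) = 0 := by linarith
      linarith [(mul_eq_zero.1 this).resolve_left h03]
    have h01 : a 0 1 = 0 := by
      have : a 0 3 * a 0 1 = 0 := by linarith
      exact (mul_eq_zero.1 this).resolve_left h03
    refine ⟨h01, by linarith, h02, by linarith, e12, hc, ?_⟩
    rw [h01, h02] at hr
    have : (a 0 3 - √3 / 2) * (a 0 3 + √3 / 2) = 0 := by linarith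
    rcases mul_eq_zero.1 this with h | h
    · left; linarith
    · right; linarith
  · left
    rw [hc] at d1 d2 d3 h1 h2 h3
    have e12 : a 1 2 = -a 0 3 := by linarith
    have e13 : a 1 3 = a 0 2 := by linarith
    have e23 : a 2 3 = -a 0 1 := by linarith
    rw [e12] at h2
    have h03 : a 0 3 = 0 := by linarith
    rw [e13, e23, h03] at h3
    rw [h03] at hr
    have h02 : a 0 2 = 0 := by linarith
    rw [h02] at hr
    have h01 : a 0 1 ^ 2 = 1 := by linarith
    exact ⟨h02, by linarith, h03, by linarith, e23, hc, eq_one_or_of_sq h01⟩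

/-- A structure preserving the plane of `e₅, e₆` is determined by seven entries. -/
theorem fundamentalForm_eq_of_block {e : Basis (Fin 6) ℝ L} {J : Module.End ℝ L}
    (hJ : IsCompatible e J) {a : Fin 6 → Fin 6 → ℝ} (hcf : ∀ i j, coframe e j (J (e i)) = a i j)
    (h : ∀ i : Fin 6, i < 4 → a i 4 = 0 ∧ a i 5 = 0) {η : LinearMap.BilinForm ℝ L}
    (hη : η ∈ spaceZ e) (h' : ∀ i : Fin 6, i < 4 → η (e i) (e 4) = 0 ∧ η (e i) (e 5) = 0)
    (h1 : a 0 1 = η (e 0) (e 1)) (h2 : a 0 2 = η (e 0) (e 2)) (h3 : a 0 3 = η (e 0) (e 3))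
    (h4 : a 1 2 = η (e 1) (e 2)) (h5 : a 1 3 = η (e 1) (e 3)) (h6 : a 2 3 = η (e 2) (e 3))
    (h7 : a 4 5 = η (e 4) (e 5)) : fundamentalForm e J = η := by
  refine fundamentalForm_eq hJ hη fun i j hij => ?_
  rw [hcf]
  fin_cases i <;> fin_cases j <;> first
    | exact absurd hij (by decide)
    | assumption
    | exact (h _ (by decide)).1.trans (h' _ (by decide)).1.symm
    | exact (h _ (by decide)).2.trans (h' _ (by decide)).2.symm

/-- The components `N(e₅, ·, e₅)`, `N(e₆, ·, e₆)` and the cyclic identities mixing `e₅` and `e₆`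
give `c² = 1`. Once `J` preserves `⟨e₅, e₆⟩`, the cyclic identity for `e₁, e_k, e₅` gives the
equations on the block. -/
theorem entries_of_mem_Z134 {e : Basis (Fin 6) ℝ L} (he : StructureEquations e)
    {J : Module.End ℝ L} (hJ : IsCompatible e J)
    (h : covDeriv e (fundamentalForm e J) ∈ ghW1 J ⊔ ghW3 e J ⊔ ghW4 e J)
    {a : Fin 6 → Fin 6 → ℝ} (hcf : ∀ i j, coframe e j (J (e i)) = a i j)
    (ha : IsComplexMatrix a) :
    a 4 5 ^ 2 = 1 ∧ (a 0 3 * a 0 1 + a 0 1 * a 1 2) * a 4 5 = 0 ∧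
      a 1 2 + (a 0 3 * a 0 2 + a 0 2 * a 1 2) * a 4 5 = 0 ∧
      a 1 3 + (a 0 3 ^ 2 - a 0 1 * a 2 3 + a 0 2 * a 1 3 - 1) * a 4 5 = 0 := by
  have s := ha.skew
  have hN := nijenhuis_swap_right hJ (twist_diagonal_of_mem hJ h)
  have hN1 : ∀ Y Z, nijenhuis e J Y Z Y = 0 := fun Y Z => by
    have h1 := hN Y Z Y
    have h2 := nijenhuis_swap_left (e := e) (J := J) Y Y Z
    linarith
  have hN2 : ∀ X Y Z, nijenhuis e J X Y Z = nijenhuis e J Z X Y := fun X Y Z => by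
    rw [hN, nijenhuis_swap_left, neg_neg]
  simp only [nijenhuis, metric_lie he, cf2_apply] at hN1 hN2
  have hi := fun k => hN1 (e 4) (e k)
  have hj := fun k => hN1 (e 5) (e k)
  have hk := fun k => hN2 (e 4) (e k) (e 5)
  have hl := fun k => hN2 (e 0) (e k) (e 4)
  simp only [coframe_basis, hcf, ha.diag, s 0 4, s 1 4, s 2 4, s 3 4, s 0 5, s 1 5, s 2 5, s 3 5,
    s 5 4] at hi hj hk hl
  have hc : a 4 5 ^ 2 = 1 := by
    apply ha.sq_eq_one_of_integrable
    · have := hi 0; simp [ha.diag] at this; linear_combination -this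
    · have := hi 1; simp [ha.diag, s 1 0] at this; linear_combination -this
    · have := hi 2; simp [-mul_eq_zero, ha.diag, s 2 0, s 2 1] at this; linear_combination -this
    · have := hi 3; simp [-mul_eq_zero, ha.diag, s 3 0, s 3 1,
      s 3 2] at this; linear_combination -this
    · have := hj 0; simp [ha.diag] at this; linear_combination -this
    · have := hj 1; simp [ha.diag, s 1 0] at this; linear_combination -this
    · have := hj 2; simp [ha.diag, s 2 0, s 2 1] at this; linear_combination -this
    · have := hj 3; simp [ha.diag, s 3 0, s 3 1, s 3 2] at this; linear_combination -this
    · have := hk 0; simp [ha.diag, s 0 4, s 0 5] at this; linear_combination -this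
    · have := hk 1; simp [ha.diag, s 1 0, s 1 4, s 1 5] at this; linear_combination -this
    · have := hk 2; simp [ha.diag, s 2 0, s 2 1, s 2 4, s 2 5] at this; linear_combination -this
    · have := hk 3; simp [ha.diag, s 3 0, s 3 1, s 3 2, s 3 4, s 3 5] at this
      linear_combination -this
  obtain ⟨⟨z0, z1, z2, z3⟩, w0, w1, w2, w3⟩ := ha.rows_eq_zero_of_sq_eq_one hc
  have h1 := hl 1
  have h2 := hl 2
  have h3 := hl 3
  simp [-mul_eq_zero, ha.diag, s 1 0, s 2 0, s 2 1, s 3 0, s 3 1, s 3 2, s 1 4, s 1 5, s 2 4,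
    s 2 5, s 3 4, s 3 5, z0, z1, z2, z3, w0, w1, w2, w3] at h1 h2 h3
  exact ⟨hc, by linarith, h2, by linear_combination h3⟩

theorem Z134_subset {e : Basis (Fin 6) ℝ L} (he : StructureEquations e) :
    Z134 e ⊆ {vertex1 e, vertex2 e, eps e (2 * Real.pi / 3), eps e (-(2 * Real.pi / 3))} := by
  rintro ω ⟨J, hJ, rfl, h⟩
  obtain ⟨a, hcf, ha⟩ : ∃ a : Fin 6 → Fin 6 → ℝ, (∀ i j, coframe e j (J (e i)) = a i j) ∧
    IsComplexMatrix a := ⟨_, fun _ _ => rfl, hJ.isComplexMatrix⟩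
  obtain ⟨hc, h1, h2, h3⟩ := entries_of_mem_Z134 he hJ h hcf ha
  obtain ⟨⟨z0, z1, z2, z3⟩, w0, w1, w2, w3⟩ := ha.rows_eq_zero_of_sq_eq_one hc
  have hblock : ∀ i : Fin 6, i < 4 → a i 4 = 0 ∧ a i 5 = 0 := fun i hi => by
    rw [ha.skew i 4, ha.skew i 5, neg_eq_zero, neg_eq_zero]
    fin_cases i <;> first
      | exact absurd hi (by decide)
      | exact ⟨by assumption, by assumption⟩
  have entries := @fundamentalForm_eq_of_block L _ _ e J hJ a hcf hblock
  have hcases := ha.cases_of_integrable hc h1 h2 h3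
  rw [Set.mem_insert_iff, Set.mem_insert_iff, Set.mem_insert_iff, Set.mem_singleton_iff]
  rcases hcases with ⟨q1, q2, q3, q4, q5, q6, q7 | q7⟩ | ⟨q1, q2, q3, q4, q5, q6, q7 | q7⟩
  · left
    refine entries (vertex1_mem_spaceZ e) (fun i hi => ?_) ?_ ?_ ?_ ?_ ?_ ?_ ?_
    · fin_cases i <;> first
        | exact absurd hi (by decide)
        | simp [vertex1, cf2_apply, coframe_basis]
    all_goals simp [vertex1, cf2_apply, coframe_basis, q1, q2, q3, q4, q5, q6, q7]
  · right; left
    refine entries (vertex2_mem_spaceZ e) (fun i hi => ?_) ?_ ?_ ?_ ?_ ?_ ?_ ?_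
    · fin_cases i <;> first
        | exact absurd hi (by decide)
        | simp [vertex2, cf2_apply, coframe_basis]
    all_goals simp [vertex2, cf2_apply, coframe_basis, q1, q2, q3, q4, q5, q6, q7]
  · right; right; left
    refine entries (eps_mem_spaceZ e _) (fun i hi => ?_) ?_ ?_ ?_ ?_ ?_ ?_ ?_
    · fin_cases i <;> first
        | exact absurd hi (by decide)
        | simp [eps, cf2_apply, coframe_basis]
    all_goals simp [eps, cf2_apply, coframe_basis, cos_two_pi_div_three, sin_two_pi_div_three,
      q1, q2, q3, q4, q5, q6, q7] <;> norm_num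
  · right; right; right
    refine entries (eps_mem_spaceZ e _) (fun i hi => ?_) ?_ ?_ ?_ ?_ ?_ ?_ ?_
    · fin_cases i <;> first
        | exact absurd hi (by decide)
        | simp [eps, cf2_apply, coframe_basis]
    all_goals simp [eps, cf2_apply, coframe_basis, cos_two_pi_div_three, sin_two_pi_div_three,
      q1, q2, q3, q4, q5, q6, q7] <;> norm_num

theorem Z124_subset {e : Basis (Fin 6) ℝ L} (he : StructureEquations e) :
    Z124 e ⊆ circleS e := by
  rintro ω ⟨J, hJ, rfl, h⟩
  obtain ⟨a, hcf, ha⟩ : ∃ a : Fin 6 → Fin 6 → ℝ, (∀ i j, coframe e j (J (e i)) = a i j) ∧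
    IsComplexMatrix a := ⟨_, fun _ _ => rfl, hJ.isComplexMatrix⟩
  have s := ha.skew
  have hF := koszul_eq_of_mem he hJ h rfl rfl
  obtain ⟨l, hl⟩ : ∃ l, l = a 0 1 := ⟨_, rfl⟩
  obtain ⟨m, hm⟩ : ∃ m, m = a 0 3 + a 1 2 := ⟨_, rfl⟩
  simp only [koszul, metric_lie he, cf2_apply, hcf, ← hl, ← hm] at hF
  -- With `J (e k)` in the third slot, `J² = -1` makes the terms containing `JZ` linear in the
  -- matrix entries.
  have hv := fun k => hF (e 4) (e 4) (J (e k))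
  have hw := fun k => hF (e 5) (e 5) (J (e k))
  have hx := fun k => hF (e 4) (e 5) (J (e k))
  have hy := fun k => hF (e 5) (e 4) (J (e k))
  have hr := fun k => hF (e 4) (e 5) (e k)
  have hs := fun k => hF (e 5) (e 4) (e k)
  have ht := fun k => hF (e 0) (e k) (e 4)
  have hu := fun k => hF (e k) (e 0) (e 4)
  have hp := hF (e 5) (e 5) (e 4)
  have hq := hF (e 4) (e 4) (e 5)
  simp only [hJ.sq, map_neg, coframe_basis, metric_basis_left, hcf, ha.diag, s 0 4, s 1 4, s 2 4,
    s 3 4, s 0 5, s 1 5, s 2 5, s 3 5, s 5 4] at hv hw hx hy hr hs ht hu hp hq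
  by_cases hc : a 4 5 = 0
  · have hl0 : l = 0 := by
      simp [hc] at hp; linarith
    have hm0 : m = 0 := by
      simp [hc] at hq; linarith
    obtain ⟨d1, d2, d3, d4, d5, d6⟩ := ha.duality
    -- For `c = 0` the duality relations express `m = a 0 3 + a 1 2` as minus this quantity.
    have hb : a 4 0 * a 5 3 - a 4 3 * a 5 0 + (a 4 1 * a 5 2 - a 4 2 * a 5 1) = 0 := by
      simp only [s 0 4, s 1 4, s 2 4, s 3 4, s 0 5, s 1 5, s 2 5, s 3 5, hc] at d3 d4
      rw [hm0] at hm
      linarith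
    have key := ha.rows_of_orthogonal (t := a 4 0 * a 5 1 - a 4 1 * a 5 0) hc ?_ ?_ ?_ ?_
    rotate_left
    · have h1 := hr 0
      have h2 := hs 0
      simp [hc, hl0, hm0, s 0 4, s 0 5] at h1 h2
      linear_combination (h2 - h1) / 2 + a 5 0 * hb
    · have h1 := hr 1
      have h2 := hs 1
      simp [hc, hl0, hm0, s 1 4, s 1 5] at h1 h2
      linear_combination (h2 - h1) / 2 + a 5 1 * hb
    · have h1 := hr 2
      have h2 := hs 2
      simp [hc, hl0, hm0, s 2 4, s 2 5] at h1 h2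
      linear_combination (h2 - h1) / 2 + a 5 2 * hb
    · have h1 := hr 3
      have h2 := hs 3
      simp [hc, hl0, hm0, s 3 4, s 3 5] at h1 h2
      linear_combination (h2 - h1) / 2 + a 5 3 * hb
    obtain ⟨k0, k1, k2, k3, k4, k5, k6⟩ := key
    rw [circleS_eq]
    -- The parameters are read off from the term `-(A e³ + B e⁴) ∧ e⁵`.
    refine ⟨a 4 2, a 4 3, k6, fundamentalForm_eq hJ (circleForm_mem_spaceZ e (one_pow 2) k6) ?_⟩
    simp only [s 0 4, s 1 4, s 2 4, s 3 4, s 0 5, s 1 5, s 2 5, s 3 5, hc, k0, k1, k2, k3, k4,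
      k5] at d1 d2 d3 d4 d5 d6
    intro i j hij
    rw [hcf]
    fin_cases i <;> fin_cases j <;> first
      | exact absurd hij (by decide)
      | (simp [circleForm_apply, cf2_apply, coframe_basis, s 0 4, s 1 4, s 2 4, s 3 4, s 0 5,
          s 1 5, s 2 5, s 3 5, hc, k0, k1, k2, k3, k4, k5] <;> linarith)
  -- Here `c² = 1`, so `J` preserves `⟨e₅, e₆⟩`; the remaining equations then annihilate the row of
  -- `e₂`, which has norm one.
  · exfalso
    have hc1 : a 4 5 ^ 2 = 1 := by
      refine ha.sq_eq_one_of_ne_zero (l := l) (m := m) hc ?_ ?_ ?_ ?_ ?_ ?_ ?_ ?_ ?_ ?_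
      · have := hv 0
        simp [ha.diag, s 0 4, s 0 5] at this
        linear_combination this
      · have := hv 1
        simp [ha.diag, s 1 0, s 1 4, s 1 5] at this
        linear_combination this
      · have := hv 2
        simp [ha.diag, s 2 0, s 2 1, s 2 4, s 2 5] at this
        linear_combination this
      · have := hv 3
        simp [ha.diag, s 3 0, s 3 1, s 3 2, s 3 4, s 3 5] at this
        linear_combination this
      · have := hw 0
        simp [ha.diag, s 0 4, s 0 5] at this
        linear_combination -this
      · have := hw 1
        simp [ha.diag, s 1 0, s 1 4, s 1 5] at this
        linear_combination this
      · have := hw 2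
        simp [ha.diag, s 2 0, s 2 1, s 2 4, s 2 5] at this
        linear_combination -this
      · have := hw 3
        simp [ha.diag, s 3 0, s 3 1, s 3 2, s 3 4, s 3 5] at this
        linear_combination -this
      · have h1 := hx 0
        have h2 := hy 0
        simp [ha.diag, s 0 4, s 0 5] at h1 h2
        linear_combination -h1 - h2
      · have h1 := hx 1
        have h2 := hy 1
        simp [ha.diag, s 1 0, s 1 4, s 1 5] at h1 h2
        linear_combination -h1 - h2
    obtain ⟨⟨z0, z1, z2, z3⟩, w0, w1, w2, w3⟩ := ha.rows_eq_zero_of_sq_eq_one hc1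
    have t0 := ht 0
    have t2 := ht 2
    have t3 := ht 3
    have u2 := hu 2
    have u3 := hu 3
    simp [ha.diag, s 0 4, s 0 5, s 2 4, s 2 5, s 3 4, s 3 5, s 2 0, s 2 1, s 3 0, s 3 1, s 3 2,
      z0, z1, z2, z3, w0, w1,
      w2, w3] at t0 t2 t3 u2 u3
    have hr := ha.row 1
    have h12 : a 1 2 = 0 := by linarith
    have h13 : a 1 3 = 0 := by linarith
    have h01 : a 0 1 = 0 := by linarith
    simp [Fin.sum_univ_six, ha.diag, s 1 0, s 1 4, s 1 5, z1, w1, h12, h13, h01] at hr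

theorem sin_two_pi_div_three_pos : 0 < Real.sin (2 * Real.pi / 3) := by
  rw [sin_two_pi_div_three]; positivity

theorem four_points_nodup (e : Basis (Fin 6) ℝ L) :
    [vertex1 e, vertex2 e, eps e (2 * Real.pi / 3), eps e (-(2 * Real.pi / 3))].Nodup := by
  have key : ∀ {ω η : LinearMap.BilinForm ℝ L} (i j : Fin 6), ω (e i) (e j) ≠ η (e i) (e j) →
      ω ≠ η := fun i j h hω => h (by rw [hω])
  have hs := sin_two_pi_div_three_pos
  simp only [List.nodup_cons, List.mem_cons, List.not_mem_nil, or_false, not_or, not_false_eq_true,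
    List.nodup_nil, and_true]
  refine ⟨⟨key 0 1 ?_, key 0 1 ?_, key 0 1 ?_⟩, ⟨key 0 1 ?_, key 0 1 ?_⟩, key 0 3 ?_⟩
  · simp [vertex1, vertex2, cf2_apply, coframe_basis]; norm_num
  · simp [vertex1, eps, cf2_apply, coframe_basis]
  · simp [vertex1, eps, cf2_apply, coframe_basis]
  · simp [vertex2, eps, cf2_apply, coframe_basis]
  · simp [vertex2, eps, cf2_apply, coframe_basis]
  · simp only [eps, cf2_apply, coframe_basis, LinearMap.add_apply, LinearMap.smul_apply,
      Real.sin_neg]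
    simp
    intro h
    linarith

theorem eps_zero_ne_eps_pi (e : Basis (Fin 6) ℝ L) : eps e 0 ≠ eps e Real.pi := fun h => by
  have := LinearMap.congr_fun₂ h (e 0) (e 2)
  simp [eps, cf2_apply, coframe_basis] at this
  linarith

/-- Sets of forms on which two entries take different values are disjoint. -/
theorem disjoint_of_entry (e : Basis (Fin 6) ℝ L) {S T : Set (LinearMap.BilinForm ℝ L)}
    (i j : Fin 6) {x y : ℝ} (hxy : x ≠ y) (hS : ∀ ω ∈ S, ω (e i) (e j) = x)
    (hT : ∀ ω ∈ T, ω (e i) (e j) = y) : Disjoint S T :=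
  Set.disjoint_left.2 fun ω h1 h2 => hxy ((hS ω h1).symm.trans (hT ω h2))

theorem circleForm_entries (e : Basis (Fin 6) ℝ L) (s A B : ℝ) :
    circleForm e s A B (e 2) (e 3) = 0 ∧ circleForm e s A B (e 4) (e 5) = 0 := by
  simp [circleForm_apply, cf2_apply, coframe_basis]

theorem eps_entries (e : Basis (Fin 6) ℝ L) (θ : ℝ) :
    eps e θ (e 2) (e 3) = 0 ∧ eps e θ (e 4) (e 5) = 1 := by
  simp [eps, cf2_apply, coframe_basis]

/-- The terms with `e⁶` determine `A` and `B`, and those with `e⁵` then have opposite signs, so a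
common point would have `A = B = 0`. -/
theorem disjoint_circles (e : Basis (Fin 6) ℝ L) : Disjoint (circleS e) (circleS' e) := by
  rw [circleS_eq, circleS'_eq]
  refine Set.disjoint_left.2 ?_
  rintro ω ⟨A, B, h, rfl⟩ ⟨A', B', -, h'⟩
  have h1 := LinearMap.congr_fun₂ h' (e 0) (e 5)
  have h2 := LinearMap.congr_fun₂ h' (e 1) (e 5)
  have h3 := LinearMap.congr_fun₂ h' (e 2) (e 4)
  have h4 := LinearMap.congr_fun₂ h' (e 3) (e 4)
  simp [circleForm_apply, cf2_apply, coframe_basis] at h1 h2 h3 h4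
  have hA : A = 0 := by linarith
  have hB : B = 0 := by linarith
  rw [hA, hB] at h
  norm_num at h

end Classification

end NilHermitian

/-! ### Assembly of the theorem -/

theorem theorem2 {L : Type*} [LieRing L] [LieAlgebra ℝ L] (e : Module.Basis (Fin 6) ℝ L)
    (he : StructureEquations e) :
    -- the four points are distinct, the sets `𝒮` and `𝒮'` are circles
    ([vertex1 e, vertex2 e, eps e (2 * Real.pi / 3), eps e (-(2 * Real.pi / 3))].Nodup ∧
      eps e 0 ≠ eps e Real.pi ∧ IsCircle (circleS e) ∧ IsCircle (circleS' e)) ∧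
    -- `𝒵₂₃₄` contains the disjoint union of the four points and `𝒮`
    ({vertex1 e, vertex2 e, eps e (2 * Real.pi / 3), eps e (-(2 * Real.pi / 3))} ∪ circleS e
        ⊆ Z234 e ∧
      Disjoint {vertex1 e, vertex2 e, eps e (2 * Real.pi / 3), eps e (-(2 * Real.pi / 3))}
        (circleS e)) ∧
    -- `𝒵₁₃₄` consists of the four points
    Z134 e = {vertex1 e, vertex2 e, eps e (2 * Real.pi / 3), eps e (-(2 * Real.pi / 3))} ∧
    -- `𝒵₁₂₄` is the circle `𝒮`
    Z124 e = circleS e ∧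
    -- `𝒵₁₂₃` contains a disjoint union of two points and five circles
    ({eps e 0, eps e Real.pi} ∪ circleS e ∪ circleS' e ∪ equator02 e ∪ equator13 e ∪ equator12 e
        ⊆ Z123 e ∧
      [{eps e 0, eps e Real.pi}, circleS e, circleS' e, equator02 e, equator13 e,
        equator12 e].Pairwise Disjoint) := by
  -- Except for `𝒮` and `𝒮'`, the pieces of `𝒵₁₂₃` are separated by the entries `ω(e₃, e₄)` and
  -- `ω(e₅, e₆)`.
  have hS : ∀ ω ∈ circleS e, ω (e 2) (e 3) = 0 ∧ ω (e 4) (e 5) = 0 := by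
    rw [circleS_eq]
    rintro ω ⟨A, B, -, rfl⟩
    exact circleForm_entries e 1 A B
  have hS' : ∀ ω ∈ circleS' e, ω (e 2) (e 3) = 0 ∧ ω (e 4) (e 5) = 0 := by
    rw [circleS'_eq]
    rintro ω ⟨A, B, -, rfl⟩
    exact circleForm_entries e (-1) A B
  have hE : ∀ ω ∈ ({eps e 0, eps e Real.pi} : Set (LinearMap.BilinForm ℝ L)),
      ω (e 2) (e 3) = 0 ∧ ω (e 4) (e 5) = 1 := by
    rintro ω (rfl | rfl)
    exacts [eps_entries e 0, eps_entries e Real.pi]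
  have h02 : ∀ ω ∈ equator02 e, ω (e 2) (e 3) = 1 := fun ω h => (equator02_entries h).1
  have h13 : ∀ ω ∈ equator13 e, ω (e 2) (e 3) = -1 := fun ω h => (equator13_entries h).1
  have h12 : ∀ ω ∈ equator12 e, ω (e 2) (e 3) = 0 ∧ ω (e 4) (e 5) = -1 := fun ω h =>
    ⟨(equator12_entries h).2.1, (equator12_entries h).1⟩
  have hc := cos_two_pi_div_three
  have hc' : Real.cos (-(2 * Real.pi / 3)) = -1 / 2 := by rw [Real.cos_neg, hc]
  refine ⟨⟨four_points_nodup e, eps_zero_ne_eps_pi e, ?_, ?_⟩, ⟨?_, ?_⟩, ?_, ?_, ?_, ?_⟩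
  · rw [circleS_eq]; exact isCircle_circleForm e 1
  · rw [circleS'_eq]; exact isCircle_circleForm e (-1)
  · rw [circleS_eq]
    rintro ω ((rfl | rfl | rfl | rfl) | ⟨A, B, h, rfl⟩)
    exacts [(vertex1_mem he).1, (vertex2_mem he).1, (eps_mem he hc).1, (eps_mem he hc').1,
      (circleForm_mem he h).1]
  · refine Set.disjoint_left.2 fun ω h1 h2 => ?_
    have h3 := (hS ω h2).2
    rcases h1 with rfl | rfl | rfl | rfl
    · simp [vertex1, cf2_apply, coframe_basis] at h3
    · simp [vertex2, cf2_apply, coframe_basis] at h3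
    · rw [(eps_entries e _).2] at h3; exact one_ne_zero h3
    · rw [(eps_entries e _).2] at h3; exact one_ne_zero h3
  · refine (Z134_subset he).antisymm ?_
    rintro ω (rfl | rfl | rfl | rfl)
    exacts [(vertex1_mem he).2, (vertex2_mem he).2, (eps_mem he hc).2, (eps_mem he hc').2]
  · refine (Z124_subset he).antisymm ?_
    rw [circleS_eq]
    rintro ω ⟨A, B, h, rfl⟩
    exact (circleForm_mem he h).2
  · rw [circleS_eq, circleS'_eq]
    rintro ω ((((((rfl | rfl) | ⟨A, B, h, rfl⟩) | ⟨A, B, h, rfl⟩) | h) | h) | h)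
    · exact eps_mem_Z123 he Real.sin_zero
    · exact eps_mem_Z123 he Real.sin_pi
    · exact circleForm_mem_Z123 he (by norm_num) h
    · exact circleForm_mem_Z123 he (by norm_num) h
    · obtain ⟨-, q1, q2, q3⟩ := equator02_entries h
      exact mem_Z123 he h.1.1 q1 (by rw [q2, q3, add_zero])
    · obtain ⟨-, q1, q2, q3⟩ := equator13_entries h
      exact mem_Z123 he h.1.1 q1 (by rw [q2, q3, add_zero])
    · obtain ⟨-, -, q1, q2⟩ := equator12_entries h
      exact mem_Z123 he h.1.1 q1 q2
  · simp only [List.pairwise_cons, List.mem_cons, List.not_mem_nil, or_false, forall_eq_or_imp,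
      forall_eq, List.Pairwise.nil, and_true, IsEmpty.forall_iff, implies_true]
    have h01 : (0 : ℝ) ≠ 1 := zero_ne_one
    have h0m : (0 : ℝ) ≠ -1 := by norm_num
    have h1m : (1 : ℝ) ≠ -1 := by norm_num
    exact ⟨⟨disjoint_of_entry e 4 5 one_ne_zero (fun ω h => (hE ω h).2) fun ω h => (hS ω h).2,
      disjoint_of_entry e 4 5 one_ne_zero (fun ω h => (hE ω h).2) fun ω h => (hS' ω h).2,
      disjoint_of_entry e 2 3 h01 (fun ω h => (hE ω h).1) h02,
      disjoint_of_entry e 2 3 h0m (fun ω h => (hE ω h).1) h13,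
      disjoint_of_entry e 4 5 h1m (fun ω h => (hE ω h).2) fun ω h => (h12 ω h).2⟩,
      ⟨disjoint_circles e,
      disjoint_of_entry e 2 3 h01 (fun ω h => (hS ω h).1) h02,
      disjoint_of_entry e 2 3 h0m (fun ω h => (hS ω h).1) h13,
      disjoint_of_entry e 4 5 h0m (fun ω h => (hS ω h).2) fun ω h => (h12 ω h).2⟩,
      ⟨disjoint_of_entry e 2 3 h01 (fun ω h => (hS' ω h).1) h02,
      disjoint_of_entry e 2 3 h0m (fun ω h => (hS' ω h).1) h13,
      disjoint_of_entry e 4 5 h0m (fun ω h => (hS' ω h).2) fun ω h => (h12 ω h).2⟩,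
      ⟨disjoint_of_entry e 2 3 h1m h02 h13,
      disjoint_of_entry e 2 3 one_ne_zero h02 fun ω h => (h12 ω h).1⟩,
      disjoint_of_entry e 2 3 (by norm_num) h13 fun ω h => (h12 ω h).1⟩
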